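/- Let $\beta>0$, and let $H^1=H^1(\mathbb R^3)$ be the Sobolev space of complex-valued functions. For $(u,v)\in H^1\times H^1$ put $$M(u,v)=\int_{\mathbb R^3}(|u|^2+|v|^2)\,dx,\qquad A(u,v)=\int_{\mathbb R^3}(|\nabla u|^2+|\nabla v|^2)\,dx,$$ $$E(u,v)=\tfrac12A(u,v)-\tfrac14\int_{\mathbb R^3}(|u|^4+2\beta|uv|^2+|v|^4)\,dx,\qquad J(u,v)=E(u,v)+\tfrac12M(u,v),$$ $$K(u,v)=2A(u,v)-\tfrac32\int_{\mathbb R^3}(|u|^4+2\beta|uv|^2+|v|^4)\,dx,$$ and let $$J_0=\inf\{J(u,v):\ (u,v)\in H^1\times H^1\setminus\{(0,0)\},\ K(u,v)=0\}.$$ Let $(P,Q)$ be any ground state of the elliptic system $$-\Delta P+P-(|P|^2+\beta|Q|^2)P=0,\qquad -\Delta Q+Q-(|Q|^2+\beta|P|^2)Q=0\quad\text{in }\mathbb R^3,$$ that is, a distributional solution $(P,Q)\in H^1\times H^1$, $(P,Q)\ne(0,0)$, for which $J$ is least among all such nontrivial solutions. Define $$K^+=\{(u,v)\in H^1\times H^1:\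 J(u,v)<J_0,\ K(u,v)\ge0\},$$ $$\mathcal K=\{(u,v)\in H^1\times H^1:\ M(u,v)E(u,v)<M(P,Q)E(P,Q),\ M(u,v)A(u,v)<M(P,Q)A(P,Q)\}.$$ Then $K^+\varsubsetneq\mathcal K$: every element of $K^+$ belongs to $\mathcal K$, and $K^+\ne\mathcal K$. -/

import Mathlib

noncomputable section

namespace NLSSystem

open MeasureTheory TemperedDistribution
open scoped SchwartzMap LineDeriv Laplacian ENNReal

/-- The space `ℝ³`. -/
abbrev R3 : Type := EuclideanSpace ℝ (Fin 3)

/-- The complex space `L²(ℝ³)` (functions modulo equality almost everywhere). -/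
abbrev L2 : Type := Lp ℂ 2 (volume : Measure R3)

/-- The Sobolev space `H¹(ℝ³)` of complex-valued functions. -/
def H1 : Submodule ℂ L2 where
  carrier := {u | MemSobolev 1 2 (u : 𝓢'(R3, ℂ))}
  add_mem' {u v} hu hv := by
    have h := MemSobolev.add hu hv
    rw [← Lp.toTemperedDistributionCLM_apply, ← Lp.toTemperedDistributionCLM_apply, ← map_add] at h
    exact h
  zero_mem' := by
    have h := memSobolev_fun_zero R3 ℂ 1 2
    rw [← map_zero (Lp.toTemperedDistributionCLM ℂ (volume : Measure R3) 2)] at h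
    exact h
  smul_mem' c {u} hu := by
    have h := MemSobolev.smul c hu
    rw [← Lp.toTemperedDistributionCLM_apply, ← map_smul] at h
    exact h

/-- The distributional partial derivatives of an `H¹` function are `L²` functions. -/
theorem exists_partialDeriv (i : Fin 3) (u : H1) :
    ∃ g : L2, ∂_{EuclideanSpace.single i (1 : ℝ)} ((u : L2) : 𝓢'(R3, ℂ)) = (g : 𝓢'(R3, ℂ)) := by
  have h := MemSobolev.lineDerivOp (m := EuclideanSpace.single i (1 : ℝ)) u.2
  rw [sub_self, memSobolev_zero_iff] at h
  exact h

/-- The weak partial derivative `∂ᵢ u ∈ L²(ℝ³)` of `u ∈ H¹(ℝ³)`. -/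
def partialDeriv (i : Fin 3) (u : H1) : L2 := (exists_partialDeriv i u).choose

theorem partialDeriv_spec (i : Fin 3) (u : H1) :
    ∂_{EuclideanSpace.single i (1 : ℝ)} ((u : L2) : 𝓢'(R3, ℂ)) =
      (partialDeriv i u : 𝓢'(R3, ℂ)) :=
  (exists_partialDeriv i u).choose_spec

/-- The weak partial derivative is determined by the distributional derivative. -/
theorem eq_partialDeriv (i : Fin 3) (u : H1) (g : L2)
    (hg : ∂_{EuclideanSpace.single i (1 : ℝ)} ((u : L2) : 𝓢'(R3, ℂ)) = (g : 𝓢'(R3, ℂ))) :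
    g = partialDeriv i u := by
  rw [partialDeriv_spec, ← Lp.toTemperedDistributionCLM_apply,
    ← Lp.toTemperedDistributionCLM_apply] at hg
  exact (LinearMap.ker_eq_bot.1 (Lp.ker_toTemperedDistributionCLM_eq_bot (p := 2)) hg).symm

/-- The mass `M(u,v) = ∫ |u|² + |v|²`. -/
def mass (w : H1 × H1) : ℝ :=
  ∫ x : R3, (‖(w.1 : L2) x‖ ^ 2 + ‖(w.2 : L2) x‖ ^ 2)

/-- `A(u,v) = ∫ |∇u|² + |∇v|²`. -/
def gradSq (w : H1 × H1) : ℝ :=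
  ∫ x : R3, ((∑ i, ‖partialDeriv i w.1 x‖ ^ 2) + (∑ i, ‖partialDeriv i w.2 x‖ ^ 2))

/-- The quartic term `∫ |u|⁴ + 2β|uv|² + |v|⁴`. -/
def quartic (β : ℝ) (w : H1 × H1) : ℝ :=
  ∫ x : R3, (‖(w.1 : L2) x‖ ^ 4 + 2 * β * ‖(w.1 : L2) x * (w.2 : L2) x‖ ^ 2
    + ‖(w.2 : L2) x‖ ^ 4)

/-- The energy `E(u,v)`. -/
def energy (β : ℝ) (w : H1 × H1) : ℝ :=
  1 / 2 * gradSq w - 1 / 4 * quartic β w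

/-- The action `J(u,v) = E(u,v) + M(u,v)/2`, the Lagrangian of the elliptic system below. -/
def action (β : ℝ) (w : H1 × H1) : ℝ :=
  energy β w + 1 / 2 * mass w

/-- The functional `K(u,v) = 2A(u,v) - (3/2) ∫ |u|⁴ + 2β|uv|² + |v|⁴`. -/
def virial (β : ℝ) (w : H1 × H1) : ℝ :=
  2 * gradSq w - 3 / 2 * quartic β w

/-- `J₀`, the infimum of `J` over the nonzero pairs in `H¹ × H¹` with `K = 0`. -/
def actionThreshold (β : ℝ) : ℝ :=
  sInf (action β '' {w : H1 × H1 | w ≠ 0 ∧ virial β w = 0})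

/-- `K⁺ = {(u,v) ∈ H¹ × H¹ : J(u,v) < J₀, K(u,v) ≥ 0}`. -/
def Kplus (β : ℝ) : Set (H1 × H1) :=
  {w | action β w < actionThreshold β ∧ 0 ≤ virial β w}

/-- The equation `-Δf + f - (|f|² + β|g|²) f = 0` for `f, g ∈ H¹(ℝ³)`, in the sense of tempered
distributions (the nonlinear term is in `L²` because `H¹ ⊆ L⁶`). -/
def EllipticEq (β : ℝ) (f g : H1) : Prop :=
  ∀ φ : 𝓢(R3, ℂ),
    (-Δ ((f : L2) : 𝓢'(R3, ℂ)) + ((f : L2) : 𝓢'(R3, ℂ))) φ =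
      ∫ x : R3, φ x *
        (((‖(f : L2) x‖ ^ 2 + β * ‖(g : L2) x‖ ^ 2 : ℝ) : ℂ) * (f : L2) x)

/-- `(P,Q) ∈ H¹ × H¹` solves the elliptic system
`-ΔP + P - (|P|² + β|Q|²)P = 0`, `-ΔQ + Q - (|Q|² + β|P|²)Q = 0`. -/
def IsEllipticSolution (β : ℝ) (w : H1 × H1) : Prop :=
  EllipticEq β w.1 w.2 ∧ EllipticEq β w.2 w.1

/-- A ground state: a nontrivial solution of the elliptic system in `H¹ × H¹` whose action is
least among all nontrivial solutions. -/
def IsGroundState (β : ℝ) (w : H1 × H1) : Prop :=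
  IsEllipticSolution β w ∧ w ≠ 0 ∧
    ∀ z : H1 × H1, IsEllipticSolution β z → z ≠ 0 → action β w ≤ action β z

/-- The set `𝒦` of all `(u₀,v₀) ∈ H¹ × H¹` with `M(u₀,v₀)E(u₀,v₀) < M(P,Q)E(P,Q)` and
`M(u₀,v₀)A(u₀,v₀) < M(P,Q)A(P,Q)`, where `w = (P,Q)`. -/
def scatteringSet (β : ℝ) (w : H1 × H1) : Set (H1 × H1) :=
  {z | mass z * energy β z < mass w * energy β w ∧ mass z * gradSq z < mass w * gradSq w}

end NLSSystem

end

noncomputable section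
namespace NLSSystem

open MeasureTheory TemperedDistribution Filter Topology
open scoped SchwartzMap LineDeriv Laplacian ENNReal NNReal FourierTransform ComplexConjugate

/-! Write `N` for the quartic integral. Any nontrivial solution `(P,Q)` satisfies the Nehari
identity `A + M = N` and the Pohozaev identity `A + 3M = (3/2)N`. Hence `A = 3M`, `N = 4M`, `E =
M/2`, `J = M` and `K = 0` at `(P,Q)`. So `(P,Q)` is a competitor for `J₀`, and `J₀ ≤ M(P,Q)`; only
this inequality is needed.

Inclusion: `K ≥ 0` gives `A ≤ 6E`, and `J < J₀` gives `E + M/2 < M(P,Q)`. The arithmetic-geometric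
mean inequality then yields `ME < M(P,Q)²/2 = M(P,Q)E(P,Q)`, and `MA ≤ 6ME < 3M(P,Q)² =
M(P,Q)A(P,Q)`. Strictness: under `u ↦ r u(r·)` the product `MA` is invariant while `M → ∞` as `r →
0`, so a small multiple of a fixed function satisfies both product bounds with `J ≥ J₀`
(`exists_action_ge`).

The bulk of the work is to derive the two identities for distributional solutions that are only
assumed to be in `H¹`. The embedding `H¹ ⊆ L⁶` (`memLp_six`) puts the cubic term in `L²`, so
solutions are in `H²` (`EllipticEq.exists_hessian`). Integrating by parts against Schwartz functions
then gives an energy identity (`nehari_identity`) and a stress tensor identity (`stress_identity`).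
Testing these on dilations `φ(x/(n+1))` removes the test function in the limit, which replaces any
use of decay of the solution. -/

/-! ### Fourier multipliers, Sobolev regularity and density of Schwartz functions -/

theorem toTemperedDistribution_injective {f g : L2} (h : (f : 𝓢'(R3, ℂ)) = g) : f = g := by
  rw [← Lp.toTemperedDistributionCLM_apply, ← Lp.toTemperedDistributionCLM_apply] at h
  exact LinearMap.ker_eq_bot.1 (Lp.ker_toTemperedDistributionCLM_eq_bot (p := 2)) h

theorem toTemperedDistribution_add (f g : L2) :
    ((f + g : L2) : 𝓢'(R3, ℂ)) = (f : 𝓢'(R3, ℂ)) + (g : 𝓢'(R3, ℂ)) :=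
  map_add (Lp.toTemperedDistributionCLM ℂ (volume : Measure R3) 2) f g

theorem toTemperedDistribution_smul (c : ℂ) (f : L2) :
    ((c • f : L2) : 𝓢'(R3, ℂ)) = c • (f : 𝓢'(R3, ℂ)) :=
  map_smul (Lp.toTemperedDistributionCLM ℂ (volume : Measure R3) 2) c f

/-- The Fourier transform carries `2π` in its exponent, so `Δ` has symbol `-(2π)²|ξ|²`; hence the
factor in front of `Δ`. Inverting this operator gains two derivatives, which is the source of all
regularity below. -/
theorem besselPotential_two (f : 𝓢'(R3, ℂ)) :
    besselPotential R3 ℂ 2 f = f - (((2 * Real.pi) ^ 2 : ℝ) : ℂ)⁻¹ • Δ f := by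
  rw [laplacian_eq_fourierMultiplierCLM, besselPotential]
  have h : (fun x : R3 ↦ (((1 + ‖x‖ ^ 2) ^ ((2 : ℝ) / 2) : ℝ) : ℂ)) =
      (fun _ ↦ (1 : ℂ)) + fun x : R3 ↦ Complex.ofReal (‖x‖ ^ 2) := by
    ext x
    simp
  have h1 : fourierMultiplierCLM ℂ ((fun _ ↦ (1 : ℂ)) + fun x : R3 ↦ Complex.ofReal (‖x‖ ^ 2)) f
      = f + fourierMultiplierCLM ℂ (fun x : R3 ↦ Complex.ofReal (‖x‖ ^ 2)) f := by
    simp only [fourierMultiplierCLM_apply]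
    rw [smulLeftCLM_add (by fun_prop) (by fun_prop)]
    simp [FourierTransform.fourierInv_add]
  have h2 : (((2 * Real.pi) ^ 2 : ℝ) : ℂ) ≠ 0 := by
    simp [Real.pi_ne_zero]
  rw [h, h1, ← Complex.coe_smul (-(2 * Real.pi) ^ 2), smul_smul]
  push_cast at h2 ⊢
  rw [mul_neg, inv_mul_cancel₀ h2]
  simp

theorem memSobolev_zero (f : L2) : MemSobolev 0 2 (f : 𝓢'(R3, ℂ)) :=
  memSobolev_zero_iff.2 ⟨f, rfl⟩

theorem laplacian_eq_sum_single (f : 𝓢'(R3, ℂ)) :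
    Δ f = ∑ i : Fin 3, ∂_{EuclideanSpace.single i (1 : ℝ)} (∂_{EuclideanSpace.single i (1 : ℝ)} f) := by
  rw [laplacian_eq_sum (EuclideanSpace.basisFun (Fin 3) ℝ)]
  simp

/-- An `L²` function whose distributional partial derivatives are in `L²` belongs to `H¹`. -/
theorem memSobolev_one_of_lineDerivOp {u : L2} {g : Fin 3 → L2}
    (h : ∀ i, ∂_{EuclideanSpace.single i (1 : ℝ)} (u : 𝓢'(R3, ℂ)) = (g i : 𝓢'(R3, ℂ))) :
    MemSobolev 1 2 (u : 𝓢'(R3, ℂ)) := by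
  have h1 : MemSobolev (-1) 2 (besselPotential R3 ℂ 2 (u : 𝓢'(R3, ℂ))) := by
    rw [besselPotential_two, laplacian_eq_sum_single, Fin.sum_univ_three]
    refine ((memSobolev_zero u).mono (by norm_num)).sub (MemSobolev.smul _ ?_)
    have h2 (i : Fin 3) : MemSobolev (-1) 2 (∂_{EuclideanSpace.single i (1 : ℝ)}
        (∂_{EuclideanSpace.single i (1 : ℝ)} (u : 𝓢'(R3, ℂ)))) := by
      rw [h i]
      simpa using (memSobolev_zero (g i)).lineDerivOp (m := EuclideanSpace.single i (1 : ℝ))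
    exact ((h2 0).add (h2 1)).add (h2 2)
  rw [memSobolev_besselPotential_iff] at h1
  convert h1 using 1
  norm_num

/-- Elliptic regularity: if `u` and `Δu` are in `L²`, then `u ∈ H²`. -/
theorem memSobolev_two_of_laplacian {u g : L2} (h : Δ (u : 𝓢'(R3, ℂ)) = (g : 𝓢'(R3, ℂ))) :
    MemSobolev 2 2 (u : 𝓢'(R3, ℂ)) := by
  have h1 : MemSobolev 0 2 (besselPotential R3 ℂ 2 (u : 𝓢'(R3, ℂ))) := by
    rw [besselPotential_two, h]
    exact (memSobolev_zero u).sub ((memSobolev_zero g).smul _)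
  rw [memSobolev_besselPotential_iff] at h1
  convert h1 using 1
  norm_num

/-- A bounded Fourier multiplier acts continuously on `L²`. -/
theorem exists_fourierMultiplier_L2 {m : R3 → ℂ} (hm : m.HasTemperateGrowth)
    (hb : ∃ C, ∀ x, ‖m x‖ ≤ C) :
    ∃ T : L2 → L2, Continuous T ∧
      ∀ f : L2, (T f : 𝓢'(R3, ℂ)) = fourierMultiplierCLM ℂ m (f : 𝓢'(R3, ℂ)) := by
  have hex (f : L2) : ∃ g : L2, fourierMultiplierCLM ℂ m (f : 𝓢'(R3, ℂ)) = g :=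
    memSobolev_zero_iff.1 ((memSobolev_zero f).fourierMultiplierCLM_of_bounded hm hb)
  choose T hT using hex
  let L : L2 →ₗ[ℂ] L2 :=
    { toFun := T
      map_add' := fun f g ↦ toTemperedDistribution_injective <| by
        simp only [toTemperedDistribution_add, ← hT, map_add]
      map_smul' := fun c f ↦ toTemperedDistribution_injective <| by
        simp only [toTemperedDistribution_smul, ← hT, map_smul, RingHom.id_apply] }
  refine ⟨T, ?_, fun f ↦ (hT f).symm⟩
  -- Closed graph theorem: the multiplier is continuous on tempered distributions, and `L²` embeds
  -- continuously and injectively there.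
  refine L.continuous_of_isClosed_graph ?_
  have : (L.graph : Set (L2 × L2)) = {p | fourierMultiplierCLM ℂ m
      (Lp.toTemperedDistributionCLM ℂ (volume : Measure R3) 2 p.1) =
      Lp.toTemperedDistributionCLM ℂ (volume : Measure R3) 2 p.2} := by
    ext p
    simp only [SetLike.mem_coe, LinearMap.mem_graph_iff, Set.mem_ofPred_eq,
      Lp.toTemperedDistributionCLM_apply, hT]
    exact ⟨fun h ↦ by rw [h]; rfl, fun h ↦ (toTemperedDistribution_injective h).symm⟩
  rw [this]
  exact isClosed_eq (by fun_prop) (by fun_prop)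

theorem lineDerivOp_toLp (φ : 𝓢(R3, ℂ)) (v : R3) :
    ∂_{v} ((φ.toLp 2 : L2) : 𝓢'(R3, ℂ)) = (((∂_{v} φ).toLp 2 : L2) : 𝓢'(R3, ℂ)) := by
  rw [Lp.toTemperedDistribution_toLp_eq, lineDerivOp_toTemperedDistributionCLM_eq,
    Lp.toTemperedDistribution_toLp_eq]

/-- Schwartz functions are dense in `H¹`. -/
theorem exists_schwartz_tendsto (u : H1) :
    ∃ φ : ℕ → 𝓢(R3, ℂ), Tendsto (fun n ↦ ((φ n).toLp 2 : L2)) atTop (𝓝 (u : L2)) ∧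
      ∀ i, Tendsto (fun n ↦ ((∂_{EuclideanSpace.single i (1 : ℝ)} (φ n)).toLp 2 : L2)) atTop
        (𝓝 (partialDeriv i u)) := by
  obtain ⟨g, hg⟩ := u.2
  have hgu : besselPotential R3 ℂ (-1) (g : 𝓢'(R3, ℂ)) = ((u : L2) : 𝓢'(R3, ℂ)) := by
    rw [← hg]; simp
  obtain ⟨ψ, hψ⟩ : ∃ ψ : ℕ → 𝓢(R3, ℂ),
      Tendsto (fun n ↦ ((ψ n).toLp 2 : L2)) atTop (𝓝 g) := by
    -- Approximate `g ∈ L²`, where `u` is the Bessel potential of order `-1` of `g`, and transport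
    -- the approximation back to `u`. Both symbols involved, `(1+|ξ|²)^(-1/2)` and `2πi ξᵢ
    -- (1+|ξ|²)^(-1/2)`, are bounded.
    have hd := SchwartzMap.denseRange_toLpCLM (E := R3) (F := ℂ) (p := 2)
      (μ := (volume : Measure R3)) (by norm_num)
    obtain ⟨x, hx, hlim⟩ := mem_closure_iff_seq_limit.1 (hd g)
    choose ψ hψ using hx
    exact ⟨ψ, hlim.congr fun n ↦ (hψ n).symm⟩
  set b : R3 → ℝ := fun x ↦ (1 + ‖x‖ ^ 2) ^ ((-1 : ℝ) / 2) with hb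
  have hbt : (fun x ↦ (b x : ℂ)).HasTemperateGrowth := by fun_prop
  have hbb : ∃ C, ∀ x, ‖(b x : ℂ)‖ ≤ C := by
    refine ⟨1, fun x ↦ ?_⟩
    rw [Complex.norm_real, Real.norm_eq_abs, abs_of_nonneg (by positivity)]
    exact Real.rpow_le_one_of_one_le_of_nonpos (by simp) (by norm_num)
  let φ (n : ℕ) : 𝓢(R3, ℂ) := SchwartzMap.fourierMultiplierCLM ℂ (fun x ↦ (b x : ℂ)) (ψ n)
  have hφ (n : ℕ) : (((φ n).toLp 2 : L2) : 𝓢'(R3, ℂ)) =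
      besselPotential R3 ℂ (-1) (((ψ n).toLp 2 : L2) : 𝓢'(R3, ℂ)) := by
    rw [Lp.toTemperedDistribution_toLp_eq, Lp.toTemperedDistribution_toLp_eq,
      ← fourierMultiplierCLM_toTemperedDistributionCLM_eq hbt]
    rfl
  refine ⟨φ, ?_, fun i ↦ ?_⟩
  · obtain ⟨T, hT, hTe⟩ := exists_fourierMultiplier_L2 hbt hbb
    have h1 (n : ℕ) : ((φ n).toLp 2 : L2) = T ((ψ n).toLp 2) :=
      toTemperedDistribution_injective (by rw [hTe, hφ]; rfl)
    have h2 : (u : L2) = T g := toTemperedDistribution_injective (by rw [hTe, ← hgu]; rfl)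
    simp only [h1, h2]
    exact (hT.tendsto g).comp hψ
  · have hlt : (fun x : R3 ↦
        (2 * Real.pi * Complex.I) * (inner ℝ x (EuclideanSpace.single i (1 : ℝ)) * b x : ℝ)).HasTemperateGrowth := by
      fun_prop
    have hlb : ∃ C, ∀ x : R3, ‖(2 * Real.pi * Complex.I) * (inner ℝ x (EuclideanSpace.single i (1 : ℝ)) * b x : ℝ)‖ ≤ C := by
      refine ⟨2 * Real.pi, fun x ↦ ?_⟩
      have hb0 : 0 ≤ b x := by positivity
      have h1 : |inner ℝ x (EuclideanSpace.single i (1 : ℝ))| ≤ ‖x‖ := by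
        simpa using abs_real_inner_le_norm x (EuclideanSpace.single i (1 : ℝ))
      have h2 : ‖x‖ * b x ≤ 1 := by
        have : b x = (Real.sqrt (1 + ‖x‖ ^ 2))⁻¹ := by
          rw [hb, Real.sqrt_eq_rpow, ← Real.rpow_neg (by positivity)]
          norm_num
        rw [this, ← div_eq_mul_inv, div_le_one (by positivity)]
        exact Real.le_sqrt_of_sq_le (by linarith)
      rw [norm_mul, Complex.norm_real, Real.norm_eq_abs, abs_mul, abs_of_nonneg hb0]
      have h3 : ‖(2 * Real.pi * Complex.I : ℂ)‖ = 2 * Real.pi := by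
        simp [abs_of_pos Real.pi_pos]
      rw [h3]
      have := mul_le_mul_of_nonneg_right h1 hb0
      nlinarith [Real.pi_pos]
    obtain ⟨T, hT, hTe⟩ := exists_fourierMultiplier_L2 hlt hlb
    have key (f : 𝓢'(R3, ℂ)) : ∂_{EuclideanSpace.single i (1 : ℝ)} (besselPotential R3 ℂ (-1) f) =
        fourierMultiplierCLM ℂ (fun x : R3 ↦
        (2 * Real.pi * Complex.I) * (inner ℝ x (EuclideanSpace.single i (1 : ℝ)) * b x : ℝ)) f := by
      rw [lineDeriv_eq_fourierMultiplierCLM, besselPotential,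
        fourierMultiplierCLM_fourierMultiplierCLM_apply (by fun_prop) (by fun_prop),
        ← smul_apply, ← fourierMultiplierCLM_smul (by fun_prop)]
      congr 2
      ext x
      simp [hb]
      ring
    have h1 (n : ℕ) : ((∂_{EuclideanSpace.single i (1 : ℝ)} (φ n)).toLp 2 : L2) = T ((ψ n).toLp 2) :=
      toTemperedDistribution_injective (by rw [hTe, ← lineDerivOp_toLp, hφ, key])
    have h2 : partialDeriv i u = T g :=
      toTemperedDistribution_injective (by rw [hTe, ← partialDeriv_spec, ← hgu, key])
    simp only [h1, h2]
    exact (hT.tendsto g).comp hψ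

/-! ### The Sobolev embedding into `L⁶` -/

/-- The `i`-th standard basis vector of `ℝ³`. -/
abbrev e (i : Fin 3) : R3 := EuclideanSpace.single i (1 : ℝ)

/-- The `i`-th partial derivative of a Schwartz function. -/
abbrev schwartzDeriv (i : Fin 3) (φ : 𝓢(R3, ℂ)) : 𝓢(R3, ℂ) := ∂_{e i} φ

theorem norm_le_sum_apply_single (L : R3 →L[ℝ] ℂ) : ‖L‖ ≤ ∑ i, ‖L (e i)‖ := by
  refine L.opNorm_le_bound (Finset.sum_nonneg fun _ _ ↦ norm_nonneg _) fun x ↦ ?_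
  have hx : x = ∑ i, x i • e i := by
    ext j
    fin_cases j <;> simp [Fin.sum_univ_three]
  calc ‖L x‖ = ‖∑ i, x i • L (e i)‖ := by
        conv_lhs => rw [hx]
        simp only [map_sum, map_smul]
    _ ≤ ∑ i, ‖x i • L (e i)‖ := norm_sum_le _ _
    _ ≤ ∑ i, ‖x‖ * ‖L (e i)‖ := by
        refine Finset.sum_le_sum fun i _ ↦ ?_
        rw [norm_smul]
        exact mul_le_mul_of_nonneg_right (PiLp.norm_apply_le x i) (norm_nonneg _)
    _ = (∑ i, ‖L (e i)‖) * ‖x‖ := by rw [← Finset.mul_sum, mul_comm]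

theorem eLpNorm_fderiv_le (φ : 𝓢(R3, ℂ)) :
    eLpNorm (fderiv ℝ φ) 2 volume ≤ ∑ i, eLpNorm (schwartzDeriv i φ) 2 volume := by
  calc eLpNorm (fderiv ℝ φ) 2 volume
      ≤ eLpNorm (∑ i, fun x ↦ ‖schwartzDeriv i φ x‖) 2 volume := by
        refine eLpNorm_mono_real fun x ↦ ?_
        simpa [SchwartzMap.lineDerivOp_apply_eq_fderiv] using norm_le_sum_apply_single (fderiv ℝ φ x)
    _ ≤ ∑ i, eLpNorm (fun x ↦ ‖schwartzDeriv i φ x‖) 2 volume :=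
        eLpNorm_sum_le (fun i _ ↦ (schwartzDeriv i φ).continuous.norm.aestronglyMeasurable) (by norm_num)
    _ = ∑ i, eLpNorm (schwartzDeriv i φ) 2 volume := by simp only [eLpNorm_norm]

/-- The Sobolev inequality for Schwartz functions. -/
theorem exists_eLpNorm_six_le : ∃ C : ℝ≥0, ∀ φ : 𝓢(R3, ℂ), eLpNorm φ 6 volume ≤
    C * (eLpNorm φ 2 volume + ∑ i, eLpNorm (schwartzDeriv i φ) 2 volume) := by
  let χ : ContDiffBump (0 : R3) := ⟨1, 2, one_pos, one_lt_two⟩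
  obtain ⟨B, hB⟩ : ∃ B, ∀ x, ‖fderiv ℝ χ x‖ ≤ B :=
    (χ.hasCompactSupport.fderiv ℝ).exists_bound_of_continuous
      ((χ.contDiff (n := 1)).continuous_fderiv one_ne_zero)
  have hB0 : 0 ≤ B := (norm_nonneg _).trans (hB 0)
  set K : ℝ≥0 := SNormLESNormFDerivOfEqConst ℂ (volume : Measure R3) 2
  refine ⟨K * (B.toNNReal + 1), fun φ ↦ ?_⟩
  -- The Gagliardo–Nirenberg–Sobolev inequality is applied to compactly supported functions, so `φ`
  -- is cut off at scale `n + 1`. A bound on the gradients of the cutoffs uniform in `n` suffices,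
  -- at the price of an `L²` term.
  let c (n : ℕ) (x : R3) : ℝ := χ ((1 / ((n : ℝ) + 1)) • x)
  have hc (n : ℕ) : ContDiff ℝ 1 (c n) := χ.contDiff.comp (contDiff_const_smul _)
  have hcs (n : ℕ) : HasCompactSupport (c n) :=
    χ.hasCompactSupport.comp_homeomorph
      (Homeomorph.smulOfNeZero (1 / ((n : ℝ) + 1)) (by positivity))
  have hcd (n : ℕ) (x : R3) : ‖fderiv ℝ (c n) x‖ ≤ B := by
    have h1 : fderiv ℝ (c n) x = (1 / ((n : ℝ) + 1)) • fderiv ℝ χ ((1 / ((n : ℝ) + 1)) • x) :=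
      fderiv_comp_smul _
    rw [h1, norm_smul]
    have h2 : ‖1 / ((n : ℝ) + 1)‖ ≤ 1 := by
      rw [Real.norm_of_nonneg (by positivity), div_le_one (by positivity)]
      linarith [(Nat.cast_nonneg n : (0 : ℝ) ≤ n)]
    calc _ ≤ 1 * B := mul_le_mul h2 (hB _) (norm_nonneg _) zero_le_one
      _ = B := one_mul _
  let u (n : ℕ) (x : R3) : ℂ := c n x • φ x
  have hu (n : ℕ) : ContDiff ℝ 1 (u n) := (hc n).smul (φ.smooth 1)
  have hus (n : ℕ) : HasCompactSupport (u n) := (hcs n).smul_right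
  have hlim : ∀ x, Tendsto (fun n ↦ u n x) atTop (𝓝 (φ x)) := by
    intro x
    have h1 : Tendsto (fun n : ℕ ↦ (1 / ((n : ℝ) + 1)) • x) atTop (𝓝 0) := by
      simpa using (tendsto_one_div_add_atTop_nhds_zero_nat (𝕜 := ℝ)).smul_const x
    have h2 : Tendsto (fun n ↦ c n x) atTop (𝓝 1) := by
      have := (χ.continuous.tendsto 0).comp h1
      rwa [χ.one_of_mem_closedBall (by simp [χ.rIn_pos.le])] at this
    simpa [u] using h2.smul_const (φ x)
  have hbd (n : ℕ) : eLpNorm (u n) 6 volume ≤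
      K * (eLpNorm (fderiv ℝ φ) 2 volume + B.toNNReal * eLpNorm φ 2 volume) := by
    have h1 := eLpNorm_le_eLpNorm_fderiv_of_eq (volume : Measure R3) (hu n) (hus n)
      (p := 2) (p' := 6) (by norm_num) (by simp) (by simp; norm_num)
    refine h1.trans (mul_le_mul_right ?_ _)
    have h2 : ∀ x, ‖fderiv ℝ (u n) x‖ ≤ ((fun x ↦ ‖fderiv ℝ φ x‖) + fun x ↦ B * ‖φ x‖) x := by
      intro x
      have hd : fderiv ℝ (u n) x = c n x • fderiv ℝ φ x + (fderiv ℝ (c n) x).smulRight (φ x) :=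
        fderiv_fun_smul ((hc n).differentiable one_ne_zero x) φ.differentiableAt
      rw [hd]
      refine (norm_add_le _ _).trans (add_le_add ?_ ?_)
      · rw [norm_smul, Real.norm_of_nonneg χ.nonneg]
        exact mul_le_of_le_one_left (norm_nonneg _) χ.le_one
      · rw [ContinuousLinearMap.norm_smulRight_apply]
        exact mul_le_mul_of_nonneg_right (hcd n x) (norm_nonneg _)
    refine (eLpNorm_mono_real h2).trans ?_
    refine (eLpNorm_add_le ?_ ?_ (by norm_num)).trans ?_
    · exact (((φ.smooth 1).continuous_fderiv one_ne_zero).norm).aestronglyMeasurable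
    · exact (φ.continuous.norm.const_mul _).aestronglyMeasurable
    · refine add_le_add (by simp [eLpNorm_norm]) ?_
      have h3 : (fun x ↦ B * ‖φ x‖) = B • fun x ↦ ‖φ x‖ := rfl
      rw [h3, eLpNorm_const_smul, eLpNorm_norm, Real.enorm_eq_ofReal hB0]
      rfl
  have hfin : eLpNorm φ 6 volume ≤
      K * (eLpNorm (fderiv ℝ φ) 2 volume + B.toNNReal * eLpNorm φ 2 volume) := by
    -- Fatou's lemma removes the cutoff.
    refine (Lp.eLpNorm_lim_le_liminf_eLpNorm
      (fun n ↦ (hu n).continuous.aestronglyMeasurable) φ (Eventually.of_forall hlim)).trans ?_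
    exact (liminf_le_liminf (Eventually.of_forall hbd)).trans (by simp)
  refine hfin.trans ?_
  push_cast
  rw [mul_assoc]
  refine mul_le_mul_right ?_ _
  rw [add_mul, one_mul, mul_add, add_comm (eLpNorm (fderiv ℝ φ) 2 volume)]
  exact add_le_add le_self_add ((eLpNorm_fderiv_le φ).trans le_add_self)

/-- The Sobolev embedding `H¹(ℝ³) ⊆ L⁶(ℝ³)`. -/
theorem memLp_six (u : H1) : MemLp (u : L2) 6 volume := by
  obtain ⟨C, hC⟩ := exists_eLpNorm_six_le
  obtain ⟨φ, hφ, hφ'⟩ := exists_schwartz_tendsto u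
  -- An almost everywhere convergent subsequence, so that Fatou's lemma carries the `L⁶` bound to
  -- the limit.
  obtain ⟨ns, hns, hae⟩ := (tendstoInMeasure_of_tendsto_Lp hφ).exists_seq_tendsto_ae
  have hbd {ψ : ℕ → 𝓢(R3, ℂ)} {v : L2} (h : Tendsto (fun n ↦ ((ψ n).toLp 2 : L2)) atTop (𝓝 v)) :
      ∃ B : ℝ≥0, ∀ n, eLpNorm (ψ n) 2 volume ≤ B := by
    obtain ⟨B, hB⟩ := h.norm.bddAbove_range
    refine ⟨B.toNNReal, fun n ↦ ?_⟩
    have h1 : ‖((ψ n).toLp 2 : L2)‖ ≤ B := hB (Set.mem_range_self n)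
    rw [SchwartzMap.norm_toLp] at h1
    have h2 : eLpNorm (ψ n) 2 volume ≠ ∞ := ((ψ n).memLp 2 volume).eLpNorm_lt_top.ne
    calc eLpNorm (ψ n) 2 volume = ENNReal.ofReal (eLpNorm (ψ n) 2 volume).toReal :=
          (ENNReal.ofReal_toReal h2).symm
      _ ≤ ENNReal.ofReal B := ENNReal.ofReal_le_ofReal h1
  obtain ⟨B, hB⟩ := hbd hφ
  choose B' hB' using fun i ↦ hbd (hφ' i)
  refine ⟨(Lp.memLp (u : L2)).1, ?_⟩
  refine (Lp.eLpNorm_lim_le_liminf_eLpNorm (fun n ↦ (Lp.memLp _).1) _ hae).trans_lt ?_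
  have h2 : ∀ n, eLpNorm ((φ (ns n)).toLp 2 volume) 6 volume ≤ C * (B + ∑ i, (B' i : ℝ≥0∞)) := by
    intro n
    rw [eLpNorm_congr_ae ((φ (ns n)).coeFn_toLp 2 volume)]
    refine (hC _).trans ?_
    refine mul_le_mul_right (add_le_add (hB _) ?_) _
    exact Finset.sum_le_sum fun i _ ↦ hB' i _
  refine (liminf_le_liminf (Eventually.of_forall h2)).trans_lt ?_
  simp only [liminf_const]
  exact ENNReal.mul_lt_top (by simp) (by simp)

theorem integrable_norm_sq (u : L2) : Integrable (fun x ↦ ‖u x‖ ^ 2) :=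
  (Lp.memLp u).integrable_norm_pow two_ne_zero

theorem integrable_norm_pow_six (u : H1) : Integrable (fun x ↦ ‖(u : L2) x‖ ^ 6) :=
  (memLp_six u).integrable_norm_pow (by norm_num)

/-- Interpolation in its pointwise form `t⁴ ≤ t² + t⁶`. -/
theorem integrable_norm_pow_four (u : H1) : Integrable (fun x ↦ ‖(u : L2) x‖ ^ 4) := by
  refine ((integrable_norm_sq (u : L2)).add (integrable_norm_pow_six u)).mono'
    ((Lp.memLp (u : L2)).1.norm.pow 4) (Eventually.of_forall fun x ↦ ?_)
  rw [Real.norm_of_nonneg (by positivity)]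
  simp only [Pi.add_apply]
  nlinarith [sq_nonneg (‖(u : L2) x‖ * (‖(u : L2) x‖ ^ 2 - 1)), sq_nonneg (‖(u : L2) x‖), sq_nonneg (‖(u : L2) x‖ ^ 3)]

/-! ### Calculus of weak gradients -/

theorem lineDerivOp_eq_iff (i : Fin 3) (u g : L2) :
    ∂_{e i} (u : 𝓢'(R3, ℂ)) = (g : 𝓢'(R3, ℂ)) ↔
      ∀ φ : 𝓢(R3, ℂ), ∫ x, φ x * g x = -∫ x, schwartzDeriv i φ x * u x := by
  constructor
  · intro h φ
    have := congrArg (fun T : 𝓢'(R3, ℂ) ↦ T φ) h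
    simpa [lineDerivOp_apply_apply, integral_neg] using this.symm
  · intro h
    ext φ
    simpa [lineDerivOp_apply_apply, integral_neg] using (h φ).symm

/-- The function `u` belongs to `H¹(ℝ³)` and has the weak gradient `g`. -/
def HasWeakGrad (u : R3 → ℂ) (g : Fin 3 → R3 → ℂ) : Prop :=
  ∃ w : H1, (w : L2) =ᵐ[volume] u ∧ ∀ i, partialDeriv i w =ᵐ[volume] g i

theorem hasWeakGrad_coe (w : H1) : HasWeakGrad (w : L2) fun i ↦ partialDeriv i w :=
  ⟨w, .rfl, fun _ ↦ .rfl⟩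

namespace HasWeakGrad

variable {u v : R3 → ℂ} {g h : Fin 3 → R3 → ℂ}

theorem memLp (H : HasWeakGrad u g) : MemLp u 2 := by
  obtain ⟨w, h1, -⟩ := H
  exact (memLp_congr_ae h1).1 (Lp.memLp _)

theorem memLp_grad (H : HasWeakGrad u g) (i : Fin 3) : MemLp (g i) 2 := by
  obtain ⟨w, -, h2⟩ := H
  exact (memLp_congr_ae (h2 i)).1 (Lp.memLp _)

theorem integrable_pow_four (H : HasWeakGrad u g) : Integrable fun x ↦ ‖u x‖ ^ 4 := by
  obtain ⟨w, h1, -⟩ := H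
  refine (integrable_norm_pow_four w).congr ?_
  filter_upwards [h1] with x hx
  rw [hx]

theorem of_integral (hu : MemLp u 2) (hg : ∀ i, MemLp (g i) 2)
    (H : ∀ i (φ : 𝓢(R3, ℂ)), ∫ x, φ x * g i x = -∫ x, schwartzDeriv i φ x * u x) :
    HasWeakGrad u g := by
  have h1 (i : Fin 3) : ∂_{e i} ((hu.toLp u : L2) : 𝓢'(R3, ℂ)) =
      (((hg i).toLp (g i) : L2) : 𝓢'(R3, ℂ)) := by
    rw [lineDerivOp_eq_iff]
    intro φ
    rw [integral_congr_ae (g := fun x ↦ φ x * g i x), integral_congr_ae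
      (f := fun x ↦ schwartzDeriv i φ x * hu.toLp u x) (g := fun x ↦ schwartzDeriv i φ x * u x)]
    · exact H i φ
    · filter_upwards [hu.coeFn_toLp] with x hx
      rw [hx]
    · filter_upwards [(hg i).coeFn_toLp] with x hx
      rw [hx]
  refine ⟨⟨hu.toLp u, memSobolev_one_of_lineDerivOp h1⟩, hu.coeFn_toLp, fun i ↦ ?_⟩
  rw [← eq_partialDeriv i ⟨hu.toLp u, memSobolev_one_of_lineDerivOp h1⟩ _ (h1 i)]
  exact (hg i).coeFn_toLp

theorem integral (H : HasWeakGrad u g) (i : Fin 3) (φ : 𝓢(R3, ℂ)) :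
    ∫ x, φ x * g i x = -∫ x, schwartzDeriv i φ x * u x := by
  obtain ⟨w, h1, h2⟩ := H
  have h3 := (lineDerivOp_eq_iff i (w : L2) (partialDeriv i w)).1 (partialDeriv_spec i w) φ
  rw [integral_congr_ae (g := fun x ↦ φ x * g i x), integral_congr_ae
      (f := fun x ↦ schwartzDeriv i φ x * (w : L2) x) (g := fun x ↦ schwartzDeriv i φ x * u x)] at h3
  · exact h3
  · filter_upwards [h1] with x hx
    rw [hx]
  · filter_upwards [h2 i] with x hx
    rw [hx]

end HasWeakGrad

/-- The complex conjugate of a Schwartz function. -/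
def conjSchwartz (φ : 𝓢(R3, ℂ)) : 𝓢(R3, ℂ) := φ.postcompCLM (Complex.conjCLE : ℂ →L[ℝ] ℂ)

theorem conjSchwartz_apply (φ : 𝓢(R3, ℂ)) (x : R3) : conjSchwartz φ x = conj (φ x) := by
  simp [conjSchwartz]

theorem schwartzDeriv_conjSchwartz (i : Fin 3) (φ : 𝓢(R3, ℂ)) (x : R3) :
    schwartzDeriv i (conjSchwartz φ) x = conj (schwartzDeriv i φ x) := by
  have h1 : (conjSchwartz φ : R3 → ℂ) = (Complex.conjCLE : ℂ →L[ℝ] ℂ) ∘ φ := by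
    ext y
    simp [conjSchwartz_apply]
  have h2 := (Complex.conjCLE : ℂ →L[ℝ] ℂ).hasFDerivAt.comp x (φ.hasFDerivAt x)
  rw [schwartzDeriv, schwartzDeriv, SchwartzMap.lineDerivOp_apply_eq_fderiv,
    SchwartzMap.lineDerivOp_apply_eq_fderiv, h1, h2.fderiv]
  simp

theorem HasWeakGrad.conj {u : R3 → ℂ} {g : Fin 3 → R3 → ℂ} (H : HasWeakGrad u g) :
    HasWeakGrad (fun x ↦ conj (u x)) fun i x ↦ conj (g i x) := by
  refine .of_integral H.memLp.star (fun i ↦ (H.memLp_grad i).star) fun i φ ↦ ?_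
  have h1 := congrArg (starRingEnd ℂ) (H.integral i (conjSchwartz φ))
  rw [map_neg, ← integral_conj, ← integral_conj] at h1
  simpa [conjSchwartz_apply, schwartzDeriv_conjSchwartz] using h1

/-- The product of two Schwartz functions. -/
def mulSchwartz (φ ψ : 𝓢(R3, ℂ)) : 𝓢(R3, ℂ) := SchwartzMap.smulLeftCLM ℂ φ ψ

theorem mulSchwartz_apply (φ ψ : 𝓢(R3, ℂ)) (x : R3) : mulSchwartz φ ψ x = φ x * ψ x := by
  simp [mulSchwartz, φ.hasTemperateGrowth]

theorem schwartzDeriv_mulSchwartz (i : Fin 3) (φ ψ : 𝓢(R3, ℂ)) (x : R3) :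
    schwartzDeriv i (mulSchwartz φ ψ) x = schwartzDeriv i φ x * ψ x + φ x * schwartzDeriv i ψ x := by
  have h1 : (mulSchwartz φ ψ : R3 → ℂ) = φ * ψ := by
    ext y
    simp [mulSchwartz_apply]
  simp only [schwartzDeriv, SchwartzMap.lineDerivOp_apply_eq_fderiv]
  rw [h1, ((φ.hasFDerivAt x).mul (ψ.hasFDerivAt x)).fderiv]
  simp
  ring

theorem memLp_schwartz_mul (φ : 𝓢(R3, ℂ)) {a : R3 → ℂ} (ha : MemLp a 2) :
    MemLp (fun x ↦ φ x * a x) 2 :=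
  MemLp.mul (p := ∞) (q := 2) ha φ.memLp_top

theorem integrable_schwartz_mul (φ : 𝓢(R3, ℂ)) {a : R3 → ℂ} (ha : Integrable a) :
    Integrable (fun x ↦ φ x * a x) := by
  rw [← memLp_one_iff_integrable] at ha ⊢
  exact MemLp.mul (p := ∞) (q := 1) ha φ.memLp_top

theorem integrable_mul_of_memLp_two {a b : R3 → ℂ} (ha : MemLp a 2) (hb : MemLp b 2) :
    Integrable fun x ↦ a x * b x :=
  ha.integrable_mul hb

theorem integrable_schwartz_mul_mul (φ : 𝓢(R3, ℂ)) {a b : R3 → ℂ} (ha : MemLp a 2)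
    (hb : MemLp b 2) : Integrable fun x ↦ φ x * (a x * b x) :=
  integrable_schwartz_mul φ (integrable_mul_of_memLp_two ha hb)

/-- The bilinear pairing is the `L²` inner product with the conjugate of `a`, hence continuous. -/
theorem tendsto_integral_mul {a : R3 → ℂ} (ha : MemLp a 2) {f : ℕ → L2} {g : L2}
    (h : Tendsto f atTop (𝓝 g)) :
    Tendsto (fun n ↦ ∫ x, a x * f n x) atTop (𝓝 (∫ x, a x * g x)) := by
  have h1 (k : L2) : ∫ x, a x * k x = inner ℂ (ha.star.toLp (star a)) k := by
    rw [MeasureTheory.L2.inner_def]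
    refine integral_congr_ae ?_
    filter_upwards [ha.star.coeFn_toLp] with x hx
    rw [hx]
    simp [mul_comm]
  simp only [h1]
  exact tendsto_const_nhds.inner h

/-- Integration by parts for the product of two `H¹` functions. -/
theorem HasWeakGrad.integral_mul {u v : R3 → ℂ} {g h : Fin 3 → R3 → ℂ} (H : HasWeakGrad u g)
    (H' : HasWeakGrad v h) (i : Fin 3) (φ : 𝓢(R3, ℂ)) :
    ∫ x, φ x * (g i x * v x + u x * h i x) = -∫ x, schwartzDeriv i φ x * (u x * v x) := by
  have hi1 := integrable_schwartz_mul_mul φ (H.memLp_grad i) H'.memLp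
  have hi2 := integrable_schwartz_mul_mul φ H.memLp (H'.memLp_grad i)
  have hgm := memLp_schwartz_mul φ (H.memLp_grad i)
  have hum := memLp_schwartz_mul φ H.memLp
  have hum' := memLp_schwartz_mul (schwartzDeriv i φ) H.memLp
  have key : (∫ x, φ x * g i x * v x) + (∫ x, φ x * u x * h i x) =
      -∫ x, schwartzDeriv i φ x * u x * v x := by
    obtain ⟨w, h1, h2⟩ := H'
    obtain ⟨ψ, hψ, hψ'⟩ := exists_schwartz_tendsto w
    have c1 := tendsto_integral_mul hgm hψ
    have c2 := tendsto_integral_mul hum (hψ' i)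
    have c3 := (tendsto_integral_mul hum' hψ).neg
    have hn (n : ℕ) : (∫ x, φ x * g i x * ((ψ n).toLp 2 : L2) x) +
        (∫ x, φ x * u x * ((∂_{EuclideanSpace.single i (1 : ℝ)} (ψ n)).toLp 2 : L2) x) =
        -∫ x, schwartzDeriv i φ x * u x * ((ψ n).toLp 2 : L2) x := by
      have a1 := (ψ n).coeFn_toLp 2 (volume : Measure R3)
      have a2 := (schwartzDeriv i (ψ n)).coeFn_toLp 2 (volume : Measure R3)
      have e1 : ∫ x, φ x * g i x * ((ψ n).toLp 2 : L2) x = ∫ x, mulSchwartz φ (ψ n) x * g i x := by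
        refine integral_congr_ae ?_
        filter_upwards [a1] with x hx
        rw [hx, mulSchwartz_apply]
        ring
      rw [e1, H.integral]
      have b1 : Integrable fun x ↦ schwartzDeriv i φ x * u x * ((ψ n).toLp 2 : L2) x :=
        integrable_mul_of_memLp_two hum' (Lp.memLp _)
      have b2 : Integrable fun x ↦ φ x * u x * ((schwartzDeriv i (ψ n)).toLp 2 : L2) x :=
        integrable_mul_of_memLp_two hum (Lp.memLp _)
      have e2 : ∫ x, schwartzDeriv i (mulSchwartz φ (ψ n)) x * u x =
          (∫ x, schwartzDeriv i φ x * u x * ((ψ n).toLp 2 : L2) x) +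
          ∫ x, φ x * u x * ((schwartzDeriv i (ψ n)).toLp 2 : L2) x := by
        rw [← integral_add b1 b2]
        refine integral_congr_ae ?_
        filter_upwards [a1, a2] with x hx hx'
        rw [hx, hx', schwartzDeriv_mulSchwartz]
        ring
      rw [e2]
      ring
    have hlim := tendsto_nhds_unique (c1.add c2) (c3.congr fun n ↦ (hn n).symm)
    rw [integral_congr_ae (g := fun x ↦ φ x * g i x * v x), integral_congr_ae
      (f := fun x ↦ φ x * u x * partialDeriv i w x) (g := fun x ↦ φ x * u x * h i x),
      integral_congr_ae (f := fun x ↦ schwartzDeriv i φ x * u x * (w : L2) x)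
      (g := fun x ↦ schwartzDeriv i φ x * u x * v x)] at hlim
    · exact hlim
    · filter_upwards [h1] with x hx
      rw [hx]
    · filter_upwards [h2 i] with x hx
      rw [hx]
    · filter_upwards [h1] with x hx
      rw [hx]
  simp only [mul_add]
  rw [integral_add hi1 hi2]
  simpa only [mul_assoc] using key

/-- Hölder's inequality `L⁴ · L⁴ ⊆ L²`, through `a²b² ≤ a⁴ + b⁴`. -/
theorem memLp_two_mul {a b : R3 → ℂ} (ha : AEStronglyMeasurable a) (hb : AEStronglyMeasurable b)
    (ha4 : Integrable fun x ↦ ‖a x‖ ^ 4) (hb4 : Integrable fun x ↦ ‖b x‖ ^ 4) :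
    MemLp (fun x ↦ a x * b x) 2 := by
  have hm : AEStronglyMeasurable (fun x ↦ a x * b x) volume := ha.mul hb
  rw [memLp_two_iff_integrable_sq_norm hm]
  refine (ha4.add hb4).mono' (hm.norm.pow 2) (Eventually.of_forall fun x ↦ ?_)
  rw [Real.norm_of_nonneg (by positivity)]
  simp only [Pi.add_apply, norm_mul]
  nlinarith [sq_nonneg (‖a x‖ ^ 2 - ‖b x‖ ^ 2), sq_nonneg (‖a x‖ ^ 2 + ‖b x‖ ^ 2)]

/-- The product of two `H¹` functions with gradients in `L⁴` belongs to `H¹`. -/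
theorem HasWeakGrad.mul {u v : R3 → ℂ} {g h : Fin 3 → R3 → ℂ} (H : HasWeakGrad u g)
    (H' : HasWeakGrad v h) (hg : ∀ i, Integrable fun x ↦ ‖g i x‖ ^ 4)
    (hh : ∀ i, Integrable fun x ↦ ‖h i x‖ ^ 4) :
    HasWeakGrad (fun x ↦ u x * v x) fun i x ↦ g i x * v x + u x * h i x :=
  .of_integral (memLp_two_mul H.memLp.1 H'.memLp.1 H.integrable_pow_four H'.integrable_pow_four)
    (fun i ↦ (memLp_two_mul (H.memLp_grad i).1 H'.memLp.1 (hg i) H'.integrable_pow_four).add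
      (memLp_two_mul H.memLp.1 (H'.memLp_grad i).1 H.integrable_pow_four (hh i)))
    fun i φ ↦ H.integral_mul H' i φ

/-! ### Removing test functions by dilation -/

/-- The dilation `x ↦ φ (r x)` of a Schwartz function. -/
def dilate (r : ℝ) (hr : r ≠ 0) (φ : 𝓢(R3, ℂ)) : 𝓢(R3, ℂ) :=
  SchwartzMap.compCLMOfContinuousLinearEquiv ℝ
    (ContinuousLinearEquiv.smulLeft (Units.mk0 r hr) : R3 ≃L[ℝ] R3) φ

theorem dilate_apply (r : ℝ) (hr : r ≠ 0) (φ : 𝓢(R3, ℂ)) (x : R3) :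
    dilate r hr φ x = φ (r • x) := rfl

theorem schwartzDeriv_dilate (r : ℝ) (hr : r ≠ 0) (φ : 𝓢(R3, ℂ)) (i : Fin 3) (x : R3) :
    schwartzDeriv i (dilate r hr φ) x = r * schwartzDeriv i φ (r • x) := by
  have h1 : (dilate r hr φ : R3 → ℂ) = fun y ↦ φ (r • y) := rfl
  simp only [schwartzDeriv, SchwartzMap.lineDerivOp_apply_eq_fderiv]
  rw [h1, fderiv_comp_smul]
  simp

theorem tendsto_integral_dilate (φ : 𝓢(R3, ℂ)) {T : R3 → ℂ} (hT : Integrable T) :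
    Tendsto (fun n : ℕ ↦ ∫ x, φ ((1 / ((n : ℝ) + 1)) • x) * T x) atTop
      (𝓝 (φ 0 * ∫ x, T x)) := by
  rw [← integral_const_mul]
  obtain ⟨C, hC⟩ : ∃ C, ∀ x, ‖φ x‖ ≤ C := ⟨_, φ.norm_le_seminorm ℝ⟩
  refine tendsto_integral_of_dominated_convergence (fun x ↦ C * ‖T x‖) (fun n ↦ ?_)
    (hT.norm.const_mul C) (fun n ↦ Eventually.of_forall fun x ↦ ?_)
    (Eventually.of_forall fun x ↦ ?_)
  · exact (φ.continuous.comp (continuous_const_smul _)).aestronglyMeasurable.mul hT.1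
  · rw [norm_mul]
    exact mul_le_mul_of_nonneg_right (hC _) (norm_nonneg _)
  · have h1 : Tendsto (fun n : ℕ ↦ (1 / ((n : ℝ) + 1)) • x) atTop (𝓝 0) := by
      simpa using (tendsto_one_div_add_atTop_nhds_zero_nat (𝕜 := ℝ)).smul_const x
    exact ((φ.continuous.tendsto 0).comp h1).mul_const _

theorem exists_schwartz_eq_one : ∃ χ : 𝓢(R3, ℂ), χ 0 = 1 := by
  let χ : ContDiffBump (0 : R3) := ⟨1, 2, one_pos, one_lt_two⟩
  have hc : HasCompactSupport (Complex.ofRealCLM ∘ χ) := χ.hasCompactSupport.comp_left rfl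
  have hs : ContDiff ℝ ((⊤ : ℕ∞) : WithTop ℕ∞) (Complex.ofRealCLM ∘ χ) := Complex.ofRealCLM.contDiff.comp χ.contDiff
  refine ⟨hc.toSchwartzMap hs, ?_⟩
  simp [χ.one_of_mem_closedBall (x := 0) (by simp [χ.rIn_pos.le])]

/-- There is a Schwartz function with prescribed gradient `eᵢ` at the origin. -/
theorem exists_schwartzDeriv_zero_eq (i : Fin 3) :
    ∃ η : 𝓢(R3, ℂ), ∀ j, schwartzDeriv j η 0 = if j = i then 1 else 0 := by
  obtain ⟨χ, hχ⟩ := exists_schwartz_eq_one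
  -- A truncated coordinate function `xᵢ χ`: at the origin the derivative of `χ` is multiplied by
  -- `xᵢ = 0`, and `χ 0 = 1`.
  let L : R3 →L[ℝ] ℂ := Complex.ofRealCLM ∘L EuclideanSpace.proj i
  refine ⟨SchwartzMap.smulLeftCLM ℂ L χ, fun j ↦ ?_⟩
  have h1 : (SchwartzMap.smulLeftCLM ℂ L χ : R3 → ℂ) = L * χ := by
    rw [SchwartzMap.smulLeftCLM_apply L.hasTemperateGrowth]
    rfl
  simp only [schwartzDeriv, SchwartzMap.lineDerivOp_apply_eq_fderiv]
  rw [h1, (L.hasFDerivAt.mul (χ.hasFDerivAt 0)).fderiv]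
  simp only [eq_comm (a := j)]
  by_cases h : i = j <;> simp [L, hχ, h]

/-- A divergence identity tested against dilations of a vector field. -/
theorem integral_eq_of_forall_sum_schwartzDeriv {S : Fin 3 → R3 → ℂ} {T : R3 → ℂ}
    (hS : ∀ j, Integrable (S j)) (hT : Integrable T) (i : Fin 3)
    (H : ∀ φ : 𝓢(R3, ℂ), ∑ j, ∫ x, schwartzDeriv j φ x * S j x = ∫ x, schwartzDeriv i φ x * T x) :
    ∫ x, S i x = ∫ x, T x := by
  obtain ⟨η, hη⟩ := exists_schwartzDeriv_zero_eq i
  have h1 (n : ℕ) : ∑ j, ∫ x, schwartzDeriv j η ((1 / ((n : ℝ) + 1)) • x) * S j x =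
      ∫ x, schwartzDeriv i η ((1 / ((n : ℝ) + 1)) • x) * T x := by
    have hr : 1 / ((n : ℝ) + 1) ≠ 0 := by positivity
    -- Every term carries one derivative, so the chain rule factor `1/(n+1)` cancels; in the limit
    -- only the gradient of `η` at the origin survives.
    have h2 := H (dilate _ hr η)
    simp only [schwartzDeriv_dilate, mul_assoc, integral_const_mul, ← Finset.mul_sum] at h2
    exact mul_left_cancel₀ (Complex.ofReal_ne_zero.2 hr) h2
  have h3 := tendsto_finsetSum Finset.univ
    fun j _ ↦ tendsto_integral_dilate (schwartzDeriv j η) (hS j)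
  have h4 := tendsto_nhds_unique (h3.congr h1) (tendsto_integral_dilate (schwartzDeriv i η) hT)
  simpa [hη] using h4

/-- The integral of a divergence with integrable flux vanishes. Here only the flux side is
differentiated, so it keeps the factor `1/(n+1)` and tends to zero. -/
theorem integral_eq_zero_of_forall_sum_schwartzDeriv {S : R3 → ℂ} {T : Fin 3 → R3 → ℂ}
    (hS : Integrable S) (hT : ∀ j, Integrable (T j))
    (H : ∀ φ : 𝓢(R3, ℂ), ∫ x, φ x * S x = ∑ j, ∫ x, schwartzDeriv j φ x * T j x) :
    ∫ x, S x = 0 := by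
  obtain ⟨χ, hχ⟩ := exists_schwartz_eq_one
  have h1 (n : ℕ) : ∫ x, χ ((1 / ((n : ℝ) + 1)) • x) * S x = ((1 / ((n : ℝ) + 1) : ℝ) : ℂ) *
      ∑ j, ∫ x, schwartzDeriv j χ ((1 / ((n : ℝ) + 1)) • x) * T j x := by
    have hr : 1 / ((n : ℝ) + 1) ≠ 0 := by positivity
    have h2 := H (dilate _ hr χ)
    simpa only [schwartzDeriv_dilate, dilate_apply, mul_assoc, integral_const_mul,
      ← Finset.mul_sum] using h2
  have h3 := tendsto_finsetSum Finset.univ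
    fun j _ ↦ tendsto_integral_dilate (schwartzDeriv j χ) (hT j)
  have h4 := (Complex.continuous_ofReal.tendsto 0).comp
    (tendsto_one_div_add_atTop_nhds_zero_nat (𝕜 := ℝ))
  have h5 := tendsto_nhds_unique ((tendsto_integral_dilate χ hS).congr h1) (h4.mul h3)
  simpa [hχ] using h5

/-! ### Stress tensor and energy identities for `-Δu + u = Vu` -/

section Stress

variable {u : R3 → ℂ} {p : Fin 3 → R3 → ℂ} {q : Fin 3 → Fin 3 → R3 → ℂ} {V : R3 → ℝ}

set_option maxHeartbeats 2000000 in
/-- The divergence identity for the stress tensor of a solution of `-Δu + u = V u`. -/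
theorem stress_identity (hu : HasWeakGrad u p) (hp : ∀ j, HasWeakGrad (p j) (q j))
    (hq : ∀ i j, q i j =ᵐ[volume] q j i) (hV : MemLp (fun x ↦ V x * u x) 2)
    (heq : (fun x ↦ ∑ j, q j j x) =ᵐ[volume] fun x ↦ u x - V x * u x)
    (i : Fin 3) (φ : 𝓢(R3, ℂ)) :
    ∑ j, ∫ x, schwartzDeriv j φ x * (p j x * conj (p i x) + conj (p j x) * p i x) =
      (∫ x, schwartzDeriv i φ x * (u x * conj (u x) + ∑ j, p j x * conj (p j x))) +
        ∫ x, φ x * (V x * (p i x * conj (u x) + u x * conj (p i x))) := by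
  have ha (j : Fin 3) := (hp j).integral_mul (hp i).conj j φ
  have hb (j : Fin 3) := (hp j).conj.integral_mul (hp i) j φ
  have hc (j : Fin 3) := (hp j).integral_mul (hp j).conj i φ
  have hd := hu.integral_mul hu.conj i φ
  have mu := hu.memLp
  have mu' := hu.conj.memLp
  have mp (j : Fin 3) := (hp j).memLp
  have mp' (j : Fin 3) := (hp j).conj.memLp
  have mq (i j : Fin 3) := (hp i).memLp_grad j
  have mq' (i j : Fin 3) := (hp i).conj.memLp_grad j
  have mul_int {a b : R3 → ℂ} (ha : MemLp a 2) (hb : MemLp b 2) :=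
    integrable_mul_of_memLp_two ha hb
  have iφ {a : R3 → ℂ} (ha : Integrable a) := integrable_schwartz_mul φ ha
  have hV' : MemLp (fun x ↦ V x * conj (u x)) 2 := by
    refine hV.star.ae_eq (Eventually.of_forall fun x ↦ ?_)
    simp
  have i1 (j : Fin 3) : Integrable fun x ↦
      φ x * (q j j x * conj (p i x) + p j x * conj (q i j x)) :=
    iφ ((mul_int (mq j j) (mp' i)).add (mul_int (mp j) (mq' i j)))
  have i2 (j : Fin 3) : Integrable fun x ↦
      φ x * (conj (q j j x) * p i x + conj (p j x) * q i j x) :=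
    iφ ((mul_int (mq' j j) (mp i)).add (mul_int (mp' j) (mq i j)))
  have i3 (j : Fin 3) : Integrable fun x ↦
      φ x * (q j i x * conj (p j x) + p j x * conj (q j i x)) :=
    iφ ((mul_int (mq j i) (mp' j)).add (mul_int (mp j) (mq' j i)))
  have i4 : Integrable fun x ↦ φ x * (p i x * conj (u x) + u x * conj (p i x)) :=
    iφ ((mul_int (mp i) mu').add (mul_int mu (mp' i)))
  have i5 : Integrable fun x ↦ φ x * (V x * (p i x * conj (u x) + u x * conj (p i x))) := by
    refine iφ (((mul_int (mp i) hV').add (mul_int hV (mp' i))).congr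
      (Eventually.of_forall fun x ↦ ?_))
    simp only [Pi.add_apply]
    ring
  have i45 : Integrable fun x ↦ φ x * (p i x * conj (u x) + u x * conj (p i x)) -
      φ x * (V x * (p i x * conj (u x) + u x * conj (p i x))) := i4.sub i5
  have i3s : Integrable fun x ↦
      ∑ j, φ x * (q j i x * conj (p j x) + p j x * conj (q j i x)) :=
    integrable_finsetSum _ fun j _ ↦ i3 j
  have i12 (j : Fin 3) : Integrable fun x ↦
      φ x * (q j j x * conj (p i x) + p j x * conj (q i j x)) +
      φ x * (conj (q j j x) * p i x + conj (p j x) * q i j x) := (i1 j).add (i2 j)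
  -- Expanding the divergence of `2 Re(∂ⱼu conj ∂ᵢu)`: the diagonal second derivatives sum to `Δu`,
  -- replaced through the equation, and the mixed ones form `∂ᵢ|∇u|²` by symmetry of the Hessian.
  have key : ∑ j, ((∫ x, φ x * (q j j x * conj (p i x) + p j x * conj (q i j x))) +
      ∫ x, φ x * (conj (q j j x) * p i x + conj (p j x) * q i j x)) =
      (∫ x, φ x * (p i x * conj (u x) + u x * conj (p i x))) -
      (∫ x, φ x * (V x * (p i x * conj (u x) + u x * conj (p i x)))) +
      ∑ j, ∫ x, φ x * (q j i x * conj (p j x) + p j x * conj (q j i x)) := by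
    rw [← integral_sub i4 i5, ← integral_finsetSum _ fun j _ ↦ i3 j,
      ← integral_add i45 i3s]
    simp only [← integral_add (i1 _) (i2 _)]
    rw [← integral_finsetSum _ fun j _ ↦ i12 j]
    refine integral_congr_ae ?_
    filter_upwards [heq, ae_all_iff.2 fun j ↦ hq i j] with x hx hsym
    have hx' := congrArg (starRingEnd ℂ) hx
    simp only [Fin.sum_univ_three, map_add, map_sub, map_mul, Complex.conj_ofReal] at hx hx' ⊢
    rw [← hsym 0, ← hsym 1, ← hsym 2]
    linear_combination (φ x * conj (p i x)) * hx + (φ x * p i x) * hx'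
  simp only [ha, hb, hc, hd] at key
  have j1 (j : Fin 3) : Integrable fun x ↦ schwartzDeriv j φ x * (p j x * conj (p i x)) :=
    integrable_schwartz_mul _ (mul_int (mp j) (mp' i))
  have j2 (j : Fin 3) : Integrable fun x ↦ schwartzDeriv j φ x * (conj (p j x) * p i x) :=
    integrable_schwartz_mul _ (mul_int (mp' j) (mp i))
  have j3 : Integrable fun x ↦ schwartzDeriv i φ x * (u x * conj (u x)) :=
    integrable_schwartz_mul _ (mul_int mu mu')
  have j4 (j : Fin 3) : Integrable fun x ↦ schwartzDeriv i φ x * (p j x * conj (p j x)) :=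
    integrable_schwartz_mul _ (mul_int (mp j) (mp' j))
  simp only [mul_add (schwartzDeriv _ φ _), Finset.mul_sum]
  have j4s : Integrable fun x ↦ ∑ j, schwartzDeriv i φ x * (p j x * conj (p j x)) :=
    integrable_finsetSum _ fun j _ ↦ j4 j
  rw [integral_add j3 j4s,
    integral_finsetSum _ fun j _ ↦ j4 j]
  simp only [integral_add (j1 _) (j2 _)]
  simp only [← neg_add, Finset.sum_neg_distrib] at key
  linear_combination -key

/-- The energy identity of a solution of `-Δu + u = V u`. -/
theorem nehari_identity (hu : HasWeakGrad u p) (hp : ∀ j, HasWeakGrad (p j) (q j))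
    (hV : MemLp (fun x ↦ V x * u x) 2)
    (heq : (fun x ↦ ∑ j, q j j x) =ᵐ[volume] fun x ↦ u x - V x * u x) :
    ∫ x, ((u x - V x * u x) * conj (u x) + ∑ j, p j x * conj (p j x)) = 0 := by
  have mu' := hu.conj.memLp
  have i1 (j : Fin 3) : Integrable fun x ↦ p j x * conj (p j x) :=
    integrable_mul_of_memLp_two (hp j).memLp (hp j).conj.memLp
  have i2 : Integrable fun x ↦ (u x - V x * u x) * conj (u x) :=
    integrable_mul_of_memLp_two (hu.memLp.sub hV) mu'
  refine integral_eq_zero_of_forall_sum_schwartzDeriv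
    (i2.add (integrable_finsetSum _ fun j _ ↦ i1 j))
    -- The integrand is the divergence of `conj(u) ∇u`.
    (T := fun j x ↦ -(p j x * conj (u x)))
    (fun j ↦ (integrable_mul_of_memLp_two (hp j).memLp mu').neg) fun φ ↦ ?_
  have ha (j : Fin 3) := (hp j).integral_mul hu.conj j φ
  have i3 (j : Fin 3) : Integrable fun x ↦
      φ x * (q j j x * conj (u x) + p j x * conj (p j x)) :=
    integrable_schwartz_mul φ
      ((integrable_mul_of_memLp_two ((hp j).memLp_grad j) mu').add (i1 j))
  simp only [mul_neg, integral_neg, ← ha]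
  rw [← integral_finsetSum _ fun j _ ↦ i3 j]
  refine integral_congr_ae ?_
  filter_upwards [heq] with x hx
  simp only [Fin.sum_univ_three] at hx ⊢
  rw [← hx]
  ring

end Stress

/-! ### Elliptic regularity of solutions -/

theorem lineDerivOp_lineDerivOp_comm (a b : R3) (f : 𝓢'(R3, ℂ)) : ∂_{a} (∂_{b} f) = ∂_{b} (∂_{a} f) := by
  simp only [lineDeriv_eq_fourierMultiplierCLM, map_smul]
  rw [fourierMultiplierCLM_fourierMultiplierCLM_apply (by fun_prop) (by fun_prop),
    fourierMultiplierCLM_fourierMultiplierCLM_apply (by fun_prop) (by fun_prop),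
    mul_comm (fun x : R3 ↦ ((inner ℝ x b : ℝ) : ℂ))]

/-- An `H¹` function with Laplacian in `L²` has second weak derivatives in `L²`. -/
theorem exists_hessian {f : H1} {k : L2}
    (h : Δ ((f : L2) : 𝓢'(R3, ℂ)) = (k : 𝓢'(R3, ℂ))) :
    ∃ q : Fin 3 → Fin 3 → R3 → ℂ, (∀ j, HasWeakGrad (partialDeriv j f) (q j)) ∧
      (∀ i j, q i j =ᵐ[volume] q j i) ∧ (fun x ↦ ∑ j, q j j x) =ᵐ[volume] k := by
  have h1 (j : Fin 3) : MemSobolev 1 2 (partialDeriv j f : 𝓢'(R3, ℂ)) := by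
    rw [← partialDeriv_spec]
    have h2 := (memSobolev_two_of_laplacian h).lineDerivOp (m := e j)
    rwa [show (2 : ℝ) - 1 = 1 by norm_num] at h2
  let d (j : Fin 3) : H1 := ⟨partialDeriv j f, h1 j⟩
  have hd (i j : Fin 3) : (partialDeriv i (d j) : 𝓢'(R3, ℂ)) =
      ∂_{e i} (∂_{e j} ((f : L2) : 𝓢'(R3, ℂ))) := by
    rw [← partialDeriv_spec, partialDeriv_spec j f]
  refine ⟨fun j i ↦ partialDeriv i (d j), fun j ↦ hasWeakGrad_coe (d j), fun i j ↦ ?_, ?_⟩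
  · have : partialDeriv j (d i) = partialDeriv i (d j) :=
      toTemperedDistribution_injective (by rw [hd, hd, lineDerivOp_lineDerivOp_comm])
    simp only [this]
    rfl
  · have : k = partialDeriv 0 (d 0) + partialDeriv 1 (d 1) + partialDeriv 2 (d 2) :=
      toTemperedDistribution_injective (by
        rw [toTemperedDistribution_add, toTemperedDistribution_add, hd, hd, hd, ← h,
          laplacian_eq_sum_single, Fin.sum_univ_three])
    rw [this]
    filter_upwards [Lp.coeFn_add (partialDeriv 0 (d 0) + partialDeriv 1 (d 1)) (partialDeriv 2 (d 2)),
      Lp.coeFn_add (partialDeriv 0 (d 0)) (partialDeriv 1 (d 1))] with x h2 h3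
    rw [h2, Pi.add_apply, h3, Fin.sum_univ_three, Pi.add_apply]

/-- The potential `|f|² + β|g|²` of the elliptic equation. -/
def potential (β : ℝ) (f g : H1) (x : R3) : ℝ := ‖(f : L2) x‖ ^ 2 + β * ‖(g : L2) x‖ ^ 2

theorem memLp_potential_mul (β : ℝ) (f g : H1) :
    MemLp (fun x ↦ (potential β f g x : ℂ) * (f : L2) x) 2 := by
  have hf := (Lp.memLp (f : L2)).1
  have hg := (Lp.memLp (g : L2)).1
  have hm : AEStronglyMeasurable (fun x ↦ (potential β f g x : ℂ) * (f : L2) x) volume :=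
    (Complex.continuous_ofReal.comp_aestronglyMeasurable
      ((hf.norm.pow 2).add ((hg.norm.pow 2).const_mul β))).mul hf
  rw [memLp_two_iff_integrable_sq_norm hm]
  -- With `a = |f|²` and `b = |g|²`, the constant comes from `(a + βb)²a ≤ 2a³ + 2β²b²a` and `b²a ≤
  -- a³ + b³`.
  refine (((integrable_norm_pow_six f).add (integrable_norm_pow_six g)).const_mul
    (2 + 2 * β ^ 2)).mono' (hm.norm.pow 2) (Eventually.of_forall fun x ↦ ?_)
  rw [Real.norm_of_nonneg (by positivity)]
  simp only [Pi.add_apply, norm_mul, Complex.norm_real, Real.norm_eq_abs, mul_pow, sq_abs, potential]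
  set a := ‖(f : L2) x‖ ^ 2 with ha
  set b := ‖(g : L2) x‖ ^ 2 with hb
  have ha0 : 0 ≤ a := by positivity
  have hb0 : 0 ≤ b := by positivity
  have h1 : ‖(f : L2) x‖ ^ 6 = a ^ 3 := by rw [ha]; ring
  have h2 : ‖(g : L2) x‖ ^ 6 = b ^ 3 := by rw [hb]; ring
  rw [h1, h2]
  have h3 : (a + β * b) ^ 2 ≤ 2 * a ^ 2 + 2 * β ^ 2 * b ^ 2 := by
    nlinarith [sq_nonneg (a - β * b)]
  have h4 : b ^ 2 * a ≤ a ^ 3 + b ^ 3 := by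
    nlinarith [mul_nonneg (add_nonneg ha0 hb0) (sq_nonneg (a - b)), mul_nonneg ha0 (sq_nonneg (a-b)),
      mul_nonneg hb0 (sq_nonneg (a-b)), pow_nonneg ha0 3, pow_nonneg hb0 3,
      mul_nonneg (pow_nonneg ha0 2) hb0]
  have h5 : 0 ≤ b ^ 3 := by positivity
  have h6 : 0 ≤ a ^ 3 := by positivity
  have h7 := mul_le_mul_of_nonneg_right h3 ha0
  have h8 := mul_le_mul_of_nonneg_left h4 (by positivity : (0 : ℝ) ≤ 2 * β ^ 2)
  nlinarith

/-- Elliptic regularity for the equation `-Δf + f = (|f|² + β|g|²) f`. -/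
theorem EllipticEq.exists_hessian {β : ℝ} {f g : H1} (h : EllipticEq β f g) :
    ∃ q : Fin 3 → Fin 3 → R3 → ℂ, (∀ j, HasWeakGrad (partialDeriv j f) (q j)) ∧
      (∀ i j, q i j =ᵐ[volume] q j i) ∧
      (fun x ↦ ∑ j, q j j x) =ᵐ[volume] fun x ↦ (f : L2) x - potential β f g x * (f : L2) x := by
  have hV := memLp_potential_mul β f g
  have h1 : Δ ((f : L2) : 𝓢'(R3, ℂ)) = (((f : L2) - hV.toLp _ : L2) : 𝓢'(R3, ℂ)) := by
    ext φ
    have h2 := h φ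
    have h3 : ((hV.toLp _ : L2) : 𝓢'(R3, ℂ)) φ = ∫ x : R3, φ x *
        (((‖(f : L2) x‖ ^ 2 + β * ‖(g : L2) x‖ ^ 2 : ℝ) : ℂ) * (f : L2) x) := by
      rw [Lp.toTemperedDistribution_apply]
      refine integral_congr_ae ?_
      filter_upwards [hV.coeFn_toLp] with x hx
      rw [hx]
      rfl
    rw [← h3] at h2
    have h4 : (((f : L2) - hV.toLp _ : L2) : 𝓢'(R3, ℂ)) =
        ((f : L2) : 𝓢'(R3, ℂ)) - ((hV.toLp _ : L2) : 𝓢'(R3, ℂ)) :=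
      map_sub (Lp.toTemperedDistributionCLM ℂ (volume : Measure R3) 2) _ _
    rw [h4]
    change -((Δ ((f : L2) : 𝓢'(R3, ℂ))) φ) + ((f : L2) : 𝓢'(R3, ℂ)) φ = _ at h2
    change _ = ((f : L2) : 𝓢'(R3, ℂ)) φ - ((hV.toLp _ : L2) : 𝓢'(R3, ℂ)) φ
    rw [← h2]
    ring
  obtain ⟨q, hq1, hq2, hq3⟩ := NLSSystem.exists_hessian h1
  refine ⟨q, hq1, hq2, hq3.trans ?_⟩
  filter_upwards [Lp.coeFn_sub (f : L2) (hV.toLp _), hV.coeFn_toLp] with x h2 h3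
  rw [h2, Pi.sub_apply, h3]

/-! ### Nehari and Pohozaev identities -/

theorem integrable_norm_mul_sq (f g : H1) : Integrable fun x ↦ ‖(f : L2) x * (g : L2) x‖ ^ 2 := by
  have h := memLp_two_mul (Lp.memLp (f : L2)).1 (Lp.memLp (g : L2)).1 (integrable_norm_pow_four f)
    (integrable_norm_pow_four g)
  exact (memLp_two_iff_integrable_sq_norm h.1).1 h

theorem mass_eq (w : H1 × H1) :
    mass w = (∫ x, ‖(w.1 : L2) x‖ ^ 2) + ∫ x, ‖(w.2 : L2) x‖ ^ 2 :=
  integral_add (integrable_norm_sq _) (integrable_norm_sq _)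

theorem gradSq_eq (w : H1 × H1) :
    gradSq w = (∑ i, ∫ x, ‖partialDeriv i w.1 x‖ ^ 2) + ∑ i, ∫ x, ‖partialDeriv i w.2 x‖ ^ 2 := by
  rw [gradSq, integral_add (integrable_finsetSum _ fun i _ ↦ integrable_norm_sq _)
    (integrable_finsetSum _ fun i _ ↦ integrable_norm_sq _),
    integral_finsetSum _ fun i _ ↦ integrable_norm_sq _,
    integral_finsetSum _ fun i _ ↦ integrable_norm_sq _]

theorem quartic_eq (β : ℝ) (w : H1 × H1) :
    quartic β w = (∫ x, ‖(w.1 : L2) x‖ ^ 4) + 2 * β * (∫ x, ‖(w.1 : L2) x * (w.2 : L2) x‖ ^ 2) +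
      ∫ x, ‖(w.2 : L2) x‖ ^ 4 := by
  have h1 := integrable_norm_pow_four w.1
  have h2 := (integrable_norm_mul_sq w.1 w.2).const_mul (2 * β)
  have h12 : Integrable fun x ↦ ‖(w.1 : L2) x‖ ^ 4 + 2 * β * ‖(w.1 : L2) x * (w.2 : L2) x‖ ^ 2 :=
    h1.add h2
  rw [quartic, integral_add h12 (integrable_norm_pow_four w.2), integral_add h1 h2,
    integral_const_mul]

theorem EllipticEq.energy_identity {β : ℝ} {f g : H1} (h : EllipticEq β f g) :
    (∫ x, ‖(f : L2) x‖ ^ 2) + ∑ i, ∫ x, ‖partialDeriv i f x‖ ^ 2 =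
      (∫ x, ‖(f : L2) x‖ ^ 4) + β * ∫ x, ‖(f : L2) x * (g : L2) x‖ ^ 2 := by
  obtain ⟨q, hq1, -, hq3⟩ := h.exists_hessian
  have key := nehari_identity (hasWeakGrad_coe f) hq1 (memLp_potential_mul β f g) hq3
  have i1 := integrable_norm_sq (f : L2)
  have i2 : Integrable fun x ↦ ∑ i, ‖partialDeriv i f x‖ ^ 2 :=
    integrable_finsetSum _ fun i _ ↦ integrable_norm_sq _
  have i3 := integrable_norm_pow_four f
  have i4 := (integrable_norm_mul_sq f g).const_mul β
  have hre : ∫ x, ((‖(f : L2) x‖ ^ 2 + ∑ i, ‖partialDeriv i f x‖ ^ 2) -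
      (‖(f : L2) x‖ ^ 4 + β * ‖(f : L2) x * (g : L2) x‖ ^ 2)) = 0 := by
    rw [← Complex.ofReal_inj, ← integral_complex_ofReal, Complex.ofReal_zero, ← key]
    refine integral_congr_ae (Eventually.of_forall fun x ↦ ?_)
    simp only [potential, Complex.mul_conj', sub_mul, norm_mul, mul_assoc]
    push_cast
    ring
  have i12 : Integrable fun x ↦ ‖(f : L2) x‖ ^ 2 + ∑ i, ‖partialDeriv i f x‖ ^ 2 := i1.add i2
  have i34 : Integrable fun x ↦ ‖(f : L2) x‖ ^ 4 + β * ‖(f : L2) x * (g : L2) x‖ ^ 2 := i3.add i4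
  rw [integral_sub i12 i34, integral_add i1 i2, integral_add i3 i4,
    integral_finsetSum _ fun i _ ↦ integrable_norm_sq _, integral_const_mul] at hre
  linarith

/-- The Nehari identity for solutions of the elliptic system. -/
theorem IsEllipticSolution.gradSq_add_mass {β : ℝ} {w : H1 × H1} (h : IsEllipticSolution β w) :
    gradSq w + mass w = quartic β w := by
  have h1 := h.1.energy_identity
  have h2 := h.2.energy_identity
  simp only [mul_comm ((w.2 : L2) _)] at h2
  rw [mass_eq, gradSq_eq, quartic_eq]
  linarith

/-- Applied to solutions, whose gradients lie in `H¹ ⊆ L⁴`, this puts the densities `|f|²` and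
`|g|²` in `H¹`; their products can then be integrated by parts in the quartic term. -/
theorem HasWeakGrad.mul_conj_self {u : R3 → ℂ} {g : Fin 3 → R3 → ℂ} (H : HasWeakGrad u g)
    (hg : ∀ i, Integrable fun x ↦ ‖g i x‖ ^ 4) :
    HasWeakGrad (fun x ↦ u x * conj (u x)) fun i x ↦ g i x * conj (u x) + u x * conj (g i x) :=
  H.mul H.conj hg fun i ↦ by simpa using hg i

section Pohozaev

variable {β : ℝ} {w : H1 × H1}

/-- The derivative of the quartic density. -/
theorem integral_potential_mul_grad {u v : R3 → ℂ} {g h : Fin 3 → R3 → ℂ} (β : ℝ)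
    (H : HasWeakGrad u g) (H' : HasWeakGrad v h) (i : Fin 3) (φ : 𝓢(R3, ℂ)) :
    (∫ x, φ x * ((u x + β * v x) * g i x)) + ∫ x, φ x * ((v x + β * u x) * h i x) =
      -∫ x, schwartzDeriv i φ x *
        (1 / 2 * (u x * u x) + β * (u x * v x) + 1 / 2 * (v x * v x)) := by
  have r11 := H.integral_mul H i φ
  have r12 := H.integral_mul H' i φ
  have r22 := H'.integral_mul H' i φ
  have mu := H.memLp
  have mv := H'.memLp
  have mg := H.memLp_grad i
  have mh := H'.memLp_grad i
  have i1 : Integrable fun x ↦ φ x * ((u x + β * v x) * g i x) :=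
    integrable_schwartz_mul_mul φ (mu.add (mv.const_mul _)) mg
  have i2 : Integrable fun x ↦ φ x * ((v x + β * u x) * h i x) :=
    integrable_schwartz_mul_mul φ (mv.add (mu.const_mul _)) mh
  have prod {a b c d : R3 → ℂ} (ha : MemLp a 2) (hb : MemLp b 2) (hc : MemLp c 2)
      (hd : MemLp d 2) : Integrable fun x ↦ φ x * (a x * b x + c x * d x) :=
    integrable_schwartz_mul φ
      ((integrable_mul_of_memLp_two ha hb).add (integrable_mul_of_memLp_two hc hd))
  have j11 := (prod mg mu mu mg).const_mul (1 / 2 : ℂ)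
  have j12 := (prod mg mv mu mh).const_mul (β : ℂ)
  have j22 := (prod mh mv mv mh).const_mul (1 / 2 : ℂ)
  have j1 : Integrable fun x ↦ 1 / 2 * (φ x * (g i x * u x + u x * g i x)) +
      β * (φ x * (g i x * v x + u x * h i x)) := j11.add j12
  have k11 := (integrable_schwartz_mul_mul (schwartzDeriv i φ) mu mu).const_mul (1 / 2 : ℂ)
  have k12 := (integrable_schwartz_mul_mul (schwartzDeriv i φ) mu mv).const_mul (β : ℂ)
  have k22 := (integrable_schwartz_mul_mul (schwartzDeriv i φ) mv mv).const_mul (1 / 2 : ℂ)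
  have k1 : Integrable fun x ↦ 1 / 2 * (schwartzDeriv i φ x * (u x * u x)) +
      β * (schwartzDeriv i φ x * (u x * v x)) := k11.add k12
  have e1 : (∫ x, φ x * ((u x + β * v x) * g i x)) + ∫ x, φ x * ((v x + β * u x) * h i x) =
      1 / 2 * (∫ x, φ x * (g i x * u x + u x * g i x)) +
      β * (∫ x, φ x * (g i x * v x + u x * h i x)) +
      1 / 2 * ∫ x, φ x * (h i x * v x + v x * h i x) := by
    rw [← integral_const_mul, ← integral_const_mul, ← integral_const_mul, ← integral_add j11 j12,
      ← integral_add j1 j22, ← integral_add i1 i2]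
    refine integral_congr_ae (Eventually.of_forall fun x ↦ ?_)
    ring
  have e2 : ∫ x, schwartzDeriv i φ x *
        (1 / 2 * (u x * u x) + β * (u x * v x) + 1 / 2 * (v x * v x)) =
      1 / 2 * (∫ x, schwartzDeriv i φ x * (u x * u x)) +
      β * (∫ x, schwartzDeriv i φ x * (u x * v x)) +
      1 / 2 * ∫ x, schwartzDeriv i φ x * (v x * v x) := by
    rw [← integral_const_mul, ← integral_const_mul, ← integral_const_mul, ← integral_add k11 k12,
      ← integral_add k1 k22]
    refine integral_congr_ae (Eventually.of_forall fun x ↦ ?_)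
    ring
  rw [e1, e2, r11, r12, r22]
  ring

-- The Pohozaev identity in a single direction: the stress tensor is tested with a field that looks
-- like `xᵢ eᵢ` at the origin. Summation over the three directions gives the usual identity.
set_option maxHeartbeats 2000000 in
theorem IsEllipticSolution.integral_grad_sq (h : IsEllipticSolution β w) (i : Fin 3) :
    2 * ((∫ x, ‖partialDeriv i w.1 x‖ ^ 2) + ∫ x, ‖partialDeriv i w.2 x‖ ^ 2) =
      mass w + gradSq w - 1 / 2 * quartic β w := by
  obtain ⟨f, g⟩ := w
  obtain ⟨q, hq1, hq2, hq3⟩ := h.1.exists_hessian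
  obtain ⟨s, hs1, hs2, hs3⟩ := h.2.exists_hessian
  simp only at hq1 hq2 hq3 hs1 hs2 hs3 ⊢
  have hf := hasWeakGrad_coe f
  have hg := hasWeakGrad_coe g
  have hρ := hf.mul_conj_self fun i ↦ (hq1 i).integrable_pow_four
  have hσ := hg.mul_conj_self fun i ↦ (hs1 i).integrable_pow_four
  have mul_int {a b : R3 → ℂ} (ha : MemLp a 2) (hb : MemLp b 2) :=
    integrable_mul_of_memLp_two ha hb
  have hS {k : H1} {t : Fin 3 → Fin 3 → R3 → ℂ} (hk : ∀ j, HasWeakGrad (partialDeriv j k) (t j))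
      (j : Fin 3) : Integrable fun x ↦ partialDeriv j k x * conj (partialDeriv i k x) +
        conj (partialDeriv j k x) * partialDeriv i k x :=
    (mul_int (hk j).memLp (hk i).conj.memLp).add (mul_int (hk j).conj.memLp (hk i).memLp)
  have hT {k : H1} {t : Fin 3 → Fin 3 → R3 → ℂ}
      (hk : ∀ j, HasWeakGrad (partialDeriv j k) (t j)) :
      Integrable fun x ↦ (k : L2) x * conj ((k : L2) x) +
        ∑ j, partialDeriv j k x * conj (partialDeriv j k x) :=
    (mul_int (hasWeakGrad_coe k).memLp (hasWeakGrad_coe k).conj.memLp).add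
      (integrable_finsetSum _ fun j _ ↦ mul_int (hk j).memLp (hk j).conj.memLp)
  have hR : Integrable fun x ↦
      1 / 2 * (((f : L2) x * conj ((f : L2) x)) * ((f : L2) x * conj ((f : L2) x))) +
      β * (((f : L2) x * conj ((f : L2) x)) * ((g : L2) x * conj ((g : L2) x))) +
      1 / 2 * (((g : L2) x * conj ((g : L2) x)) * ((g : L2) x * conj ((g : L2) x))) :=
    (((mul_int hρ.memLp hρ.memLp).const_mul _).add ((mul_int hρ.memLp hσ.memLp).const_mul _)).add
      ((mul_int hσ.memLp hσ.memLp).const_mul _)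
  have key := integral_eq_of_forall_sum_schwartzDeriv
    (S := fun j x ↦ (partialDeriv j f x * conj (partialDeriv i f x) +
        conj (partialDeriv j f x) * partialDeriv i f x) +
      (partialDeriv j g x * conj (partialDeriv i g x) +
        conj (partialDeriv j g x) * partialDeriv i g x))
    (T := fun x ↦ ((f : L2) x * conj ((f : L2) x) +
        ∑ j, partialDeriv j f x * conj (partialDeriv j f x)) +
      ((g : L2) x * conj ((g : L2) x) + ∑ j, partialDeriv j g x * conj (partialDeriv j g x)) -
      (1 / 2 * (((f : L2) x * conj ((f : L2) x)) * ((f : L2) x * conj ((f : L2) x))) +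
      β * (((f : L2) x * conj ((f : L2) x)) * ((g : L2) x * conj ((g : L2) x))) +
      1 / 2 * (((g : L2) x * conj ((g : L2) x)) * ((g : L2) x * conj ((g : L2) x)))))
    (fun j ↦ (hS hq1 j).add (hS hs1 j)) (((hT hq1).add (hT hs1)).sub hR) i (fun φ ↦ by
      have s1 := stress_identity hf hq1 hq2 (memLp_potential_mul β f g) hq3 i φ
      have s2 := stress_identity hg hs1 hs2 (memLp_potential_mul β g f) hs3 i φ
      -- The potential term of one equation alone need not be a derivative; the coupled sum is `∂ᵢ`
      -- of half the quartic density.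
      have s3 := integral_potential_mul_grad β hρ hσ i φ
      have v1 : ∀ x, (potential β f g x : ℂ) =
          (f : L2) x * conj ((f : L2) x) + β * ((g : L2) x * conj ((g : L2) x)) := fun x ↦ by
        simp only [potential, Complex.mul_conj']; push_cast; ring
      have v2 : ∀ x, (potential β g f x : ℂ) =
          (g : L2) x * conj ((g : L2) x) + β * ((f : L2) x * conj ((f : L2) x)) := fun x ↦ by
        simp only [potential, Complex.mul_conj']; push_cast; ring
      simp only [v1] at s1
      simp only [v2] at s2
      have t1 := integrable_schwartz_mul (schwartzDeriv i φ) (hT hq1)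
      have t2 := integrable_schwartz_mul (schwartzDeriv i φ) (hT hs1)
      have t3 := integrable_schwartz_mul (schwartzDeriv i φ) hR
      have t12 := t1.add t2
      have l1 (j : Fin 3) := integral_add (integrable_schwartz_mul (schwartzDeriv j φ) (hS hq1 j))
        (integrable_schwartz_mul (schwartzDeriv j φ) (hS hs1 j))
      have l2 := integral_sub t12 t3
      simp only [Pi.add_apply] at l2
      rw [integral_add t1 t2] at l2
      simp only [← mul_add, ← mul_sub] at l1 l2
      simp only [l1, l2, Finset.sum_add_distrib]
      linear_combination s1 + s2 + s3)
  have key' : ∫ x, 2 * (‖partialDeriv i f x‖ ^ 2 + ‖partialDeriv i g x‖ ^ 2) =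
      ∫ x, (((‖(f : L2) x‖ ^ 2 + ‖(g : L2) x‖ ^ 2) +
        ((∑ j, ‖partialDeriv j f x‖ ^ 2) + ∑ j, ‖partialDeriv j g x‖ ^ 2)) -
        1 / 2 * (‖(f : L2) x‖ ^ 4 + 2 * β * ‖(f : L2) x * (g : L2) x‖ ^ 2
          + ‖(g : L2) x‖ ^ 4)) := by
    rw [← Complex.ofReal_inj, ← integral_complex_ofReal, ← integral_complex_ofReal]
    convert key using 1
    · refine integral_congr_ae (Eventually.of_forall fun x ↦ ?_)
      simp only [Complex.mul_conj', Complex.conj_mul']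
      push_cast
      ring
    · refine integral_congr_ae (Eventually.of_forall fun x ↦ ?_)
      simp only [Complex.mul_conj', norm_mul]
      push_cast
      ring
  have n1 : Integrable fun x ↦ ‖(f : L2) x‖ ^ 2 + ‖(g : L2) x‖ ^ 2 :=
    (integrable_norm_sq (f : L2)).add (integrable_norm_sq (g : L2))
  have n2 : Integrable fun x ↦ (∑ j, ‖partialDeriv j f x‖ ^ 2) + ∑ j, ‖partialDeriv j g x‖ ^ 2 :=
    (integrable_finsetSum _ fun j _ ↦ integrable_norm_sq (partialDeriv j f)).add
      (integrable_finsetSum _ fun j _ ↦ integrable_norm_sq (partialDeriv j g))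
  have n3 : Integrable fun x ↦ 1 / 2 * (‖(f : L2) x‖ ^ 4 +
      2 * β * ‖(f : L2) x * (g : L2) x‖ ^ 2 + ‖(g : L2) x‖ ^ 4) :=
    (((integrable_norm_pow_four f).add ((integrable_norm_mul_sq f g).const_mul (2 * β))).add
      (integrable_norm_pow_four g)).const_mul _
  have n12 : Integrable fun x ↦ (‖(f : L2) x‖ ^ 2 + ‖(g : L2) x‖ ^ 2) +
      ((∑ j, ‖partialDeriv j f x‖ ^ 2) + ∑ j, ‖partialDeriv j g x‖ ^ 2) := n1.add n2
  rw [integral_sub n12 n3, integral_add n1 n2, integral_const_mul, integral_const_mul,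
    integral_add (integrable_norm_sq _) (integrable_norm_sq _)] at key'
  exact key'

/-- The Pohozaev identity for solutions of the elliptic system. -/
theorem IsEllipticSolution.pohozaev (h : IsEllipticSolution β w) :
    gradSq w + 3 * mass w = 3 / 2 * quartic β w := by
  have h1 := h.integral_grad_sq
  have h2 := gradSq_eq w
  simp only [Fin.sum_univ_three] at h2
  linarith [h1 0, h1 1, h1 2]

end Pohozaev

/-! ### Rescaled Schwartz pairs of large action -/

theorem memSobolev_one_toLp (φ : 𝓢(R3, ℂ)) :
    MemSobolev 1 2 ((φ.toLp 2 volume : L2) : 𝓢'(R3, ℂ)) :=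
  memSobolev_one_of_lineDerivOp (g := fun i ↦ (schwartzDeriv i φ).toLp 2 volume)
    fun i ↦ lineDerivOp_toLp φ (e i)

/-- A Schwartz function as an element of `H¹`. -/
def schwartzH1 (φ : 𝓢(R3, ℂ)) : H1 := ⟨φ.toLp 2 volume, memSobolev_one_toLp φ⟩

theorem schwartzH1_ae (φ : 𝓢(R3, ℂ)) : (schwartzH1 φ : L2) =ᵐ[volume] φ := φ.coeFn_toLp 2 volume

theorem partialDeriv_schwartzH1_ae (i : Fin 3) (φ : 𝓢(R3, ℂ)) :
    partialDeriv i (schwartzH1 φ) =ᵐ[volume] schwartzDeriv i φ := by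
  rw [← eq_partialDeriv i (schwartzH1 φ) _ (lineDerivOp_toLp φ (e i))]
  exact (schwartzDeriv i φ).coeFn_toLp 2 volume

theorem partialDeriv_zero_ae (i : Fin 3) : partialDeriv i 0 =ᵐ[volume] 0 := by
  have h : (0 : L2) = partialDeriv i 0 := by
    refine eq_partialDeriv i 0 0 ?_
    have h0 : ((0 : L2) : 𝓢'(R3, ℂ)) = 0 :=
      map_zero (Lp.toTemperedDistributionCLM ℂ (volume : Measure R3) 2)
    change ∂_{e i} ((0 : L2) : 𝓢'(R3, ℂ)) = ((0 : L2) : 𝓢'(R3, ℂ))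
    rw [h0]
    exact map_zero (LineDeriv.lineDerivOpCLM ℂ 𝓢'(R3, ℂ) (e i))
  rw [← h]
  exact Lp.coeFn_zero _ _ _

theorem mass_schwartzH1 (φ : 𝓢(R3, ℂ)) : mass (schwartzH1 φ, 0) = ∫ x, ‖φ x‖ ^ 2 := by
  refine integral_congr_ae ?_
  filter_upwards [schwartzH1_ae φ, Lp.coeFn_zero ℂ 2 (volume : Measure R3)] with x h1 h2
  change ‖(schwartzH1 φ : L2) x‖ ^ 2 + ‖(0 : L2) x‖ ^ 2 = _
  rw [h1, h2]
  simp

theorem quartic_schwartzH1 (β : ℝ) (φ : 𝓢(R3, ℂ)) :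
    quartic β (schwartzH1 φ, 0) = ∫ x, ‖φ x‖ ^ 4 := by
  refine integral_congr_ae ?_
  filter_upwards [schwartzH1_ae φ, Lp.coeFn_zero ℂ 2 (volume : Measure R3)] with x h1 h2
  change ‖(schwartzH1 φ : L2) x‖ ^ 4 + 2 * β * ‖(schwartzH1 φ : L2) x * (0 : L2) x‖ ^ 2 +
    ‖(0 : L2) x‖ ^ 4 = _
  rw [h1, h2]
  simp

theorem gradSq_schwartzH1 (φ : 𝓢(R3, ℂ)) :
    gradSq (schwartzH1 φ, 0) = ∫ x, ∑ i, ‖schwartzDeriv i φ x‖ ^ 2 := by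
  refine integral_congr_ae ?_
  filter_upwards [ae_all_iff.2 fun i ↦ partialDeriv_schwartzH1_ae i φ,
    ae_all_iff.2 fun i ↦ partialDeriv_zero_ae i] with x h1 h2
  simp [h1, h2]

theorem integral_comp_smul_R3 (F : R3 → ℝ) {r : ℝ} (hr : 0 < r) :
    ∫ x, F (r • x) = (r ^ 3)⁻¹ * ∫ x, F x := by
  rw [Measure.integral_comp_smul]
  simp [abs_of_pos hr]

/-- The rescaled function `x ↦ c φ (r x)`. -/
def rescale (c r : ℝ) (hr : 0 < r) (φ : 𝓢(R3, ℂ)) : 𝓢(R3, ℂ) := (c : ℂ) • dilate r hr.ne' φ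

theorem rescale_apply (c r : ℝ) (hr : 0 < r) (φ : 𝓢(R3, ℂ)) (x : R3) :
    rescale c r hr φ x = c * φ (r • x) := by
  simp [rescale, dilate_apply]

theorem schwartzDeriv_rescale (c r : ℝ) (hr : 0 < r) (φ : 𝓢(R3, ℂ)) (i : Fin 3) (x : R3) :
    schwartzDeriv i (rescale c r hr φ) x = c * (r * schwartzDeriv i φ (r • x)) := by
  rw [← schwartzDeriv_dilate r hr.ne' φ i x, rescale, schwartzDeriv, LineDeriv.lineDerivOp_smul]
  simp

theorem mass_rescale (c r : ℝ) (hr : 0 < r) (φ : 𝓢(R3, ℂ)) :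
    mass (schwartzH1 (rescale c r hr φ), 0) = c ^ 2 * (r ^ 3)⁻¹ * mass (schwartzH1 φ, 0) := by
  rw [mass_schwartzH1, mass_schwartzH1, mul_assoc, ← integral_comp_smul_R3 (fun x ↦ ‖φ x‖ ^ 2) hr,
    ← integral_const_mul]
  simp [rescale_apply, mul_pow]

theorem quartic_rescale (β c r : ℝ) (hr : 0 < r) (φ : 𝓢(R3, ℂ)) :
    quartic β (schwartzH1 (rescale c r hr φ), 0) =
      c ^ 4 * (r ^ 3)⁻¹ * quartic β (schwartzH1 φ, 0) := by
  rw [quartic_schwartzH1, quartic_schwartzH1, mul_assoc,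
    ← integral_comp_smul_R3 (fun x ↦ ‖φ x‖ ^ 4) hr, ← integral_const_mul]
  simp [rescale_apply, mul_pow, Even.pow_abs (show Even 4 by decide)]

theorem gradSq_rescale (c r : ℝ) (hr : 0 < r) (φ : 𝓢(R3, ℂ)) :
    gradSq (schwartzH1 (rescale c r hr φ), 0) =
      c ^ 2 * r ^ 2 * (r ^ 3)⁻¹ * gradSq (schwartzH1 φ, 0) := by
  rw [gradSq_schwartzH1, gradSq_schwartzH1, mul_assoc,
    ← integral_comp_smul_R3 (fun x ↦ ∑ i, ‖schwartzDeriv i φ x‖ ^ 2) hr, ← integral_const_mul]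
  simp only [schwartzDeriv_rescale, norm_mul, Complex.norm_real, Real.norm_eq_abs, mul_pow, sq_abs,
    Finset.mul_sum, mul_assoc]

theorem mass_nonneg (w : H1 × H1) : 0 ≤ mass w := integral_nonneg fun _ ↦ by positivity

theorem gradSq_nonneg (w : H1 × H1) : 0 ≤ gradSq w := integral_nonneg fun _ ↦ by positivity

theorem mass_pos {w : H1 × H1} (hw : w ≠ 0) : 0 < mass w := by
  refine (mass_nonneg w).lt_of_ne fun h ↦ hw ?_
  rw [mass_eq] at h
  have h1 : 0 ≤ ∫ x, ‖(w.1 : L2) x‖ ^ 2 := integral_nonneg fun _ ↦ by positivity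
  have h2 : 0 ≤ ∫ x, ‖(w.2 : L2) x‖ ^ 2 := integral_nonneg fun _ ↦ by positivity
  have aux (u : H1) (hu : ∫ x, ‖(u : L2) x‖ ^ 2 = 0) : u = 0 := by
    rw [integral_eq_zero_iff_of_nonneg (fun _ ↦ by positivity) (integrable_norm_sq _)] at hu
    refine Subtype.ext ((Lp.eq_zero_iff_ae_eq_zero).2 ?_)
    filter_upwards [hu] with x hx
    simpa using hx
  exact Prod.ext (aux _ (by linarith)) (aux _ (by linarith))

theorem exists_mass_pos : ∃ φ : 𝓢(R3, ℂ), 0 < mass (schwartzH1 φ, 0) := by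
  obtain ⟨χ, hχ⟩ := exists_schwartz_eq_one
  refine ⟨χ, mass_pos fun h ↦ ?_⟩
  have h1 : schwartzH1 χ = 0 := congrArg Prod.fst h
  have h2 : (χ.toLp 2 : L2) = 0 := congrArg Subtype.val h1
  have h3 : χ = 0 := SchwartzMap.injective_toLp (μ := (volume : Measure R3)) 2 (by
    change (χ.toLp 2 : L2) = (0 : 𝓢(R3, ℂ)).toLp 2
    rw [h2]
    exact (map_zero (SchwartzMap.toLpCLM ℂ ℂ 2 (volume : Measure R3))).symm)
  simp [h3] at hχ

/-- There are pairs with arbitrarily small `MA` and arbitrarily large action. -/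
theorem exists_action_ge (β J : ℝ) {ε : ℝ} (hε : 0 < ε) :
    ∃ w : H1 × H1, 0 ≤ quartic β w ∧ mass w * gradSq w < ε ∧ J ≤ action β w := by
  obtain ⟨φ, hm⟩ := exists_mass_pos
  set m := mass (schwartzH1 φ, 0) with hm'
  set a := gradSq (schwartzH1 φ, 0) with ha'
  set n := quartic β (schwartzH1 φ, 0) with hn'
  have ha : 0 ≤ a := gradSq_nonneg _
  have hn : 0 ≤ n := by
    rw [hn', quartic_schwartzH1]
    exact integral_nonneg fun _ ↦ by positivity
  -- The witness is `δ r φ(r x)`, with mass `δ²m/r`, gradient term `δ²ra` and quartic term `δ⁴rn`.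
  -- The product `MA = δ⁴ma` does not depend on `r`, so `δ` is fixed first.
  obtain ⟨δ, hδ, hδ'⟩ : ∃ δ : ℝ, 0 < δ ∧ δ ^ 4 * (m * a) < ε := by
    have h : Tendsto (fun δ : ℝ ↦ δ ^ 4 * (m * a)) (𝓝[>] 0) (𝓝 0) := by
      have : Tendsto (fun δ : ℝ ↦ δ ^ 4 * (m * a)) (𝓝 0) (𝓝 (0 ^ 4 * (m * a))) :=
        (Continuous.tendsto (by fun_prop) 0)
      simpa using this.mono_left nhdsWithin_le_nhds
    obtain ⟨δ, h1, h2⟩ := ((h.eventually (gt_mem_nhds hε)).and self_mem_nhdsWithin).exists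
    exact ⟨δ, h2, h1⟩
  -- Next `r` is chosen so small that half the mass exceeds `|J| + δ⁴n`; as `r ≤ 1`, the quartic
  -- term is at most `δ⁴n`.
  obtain ⟨r, hr, hr1, hrJ⟩ : ∃ r : ℝ, 0 < r ∧ r ≤ 1 ∧
      r * (|J| + δ ^ 4 * n) ≤ 1 / 2 * δ ^ 2 * m := by
    have hB : 0 < |J| + δ ^ 4 * n + 1 := by positivity
    have hA : 0 < 1 / 2 * δ ^ 2 * m := by positivity
    refine ⟨min 1 (1 / 2 * δ ^ 2 * m / (|J| + δ ^ 4 * n + 1)), by positivity, min_le_left _ _, ?_⟩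
    calc _ ≤ (1 / 2 * δ ^ 2 * m / (|J| + δ ^ 4 * n + 1)) * (|J| + δ ^ 4 * n + 1) :=
          mul_le_mul (min_le_right _ _) (by linarith) (by positivity) (by positivity)
      _ = _ := div_mul_cancel₀ _ hB.ne'
  have e1 := mass_rescale (δ * r) r hr φ
  have e2 := gradSq_rescale (δ * r) r hr φ
  have e3 := quartic_rescale β (δ * r) r hr φ
  rw [← hm'] at e1
  rw [← ha'] at e2
  rw [← hn'] at e3
  refine ⟨(schwartzH1 (rescale (δ * r) r hr φ), 0), ?_, ?_, ?_⟩
  · rw [e3]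
    positivity
  · rw [e1, e2]
    convert hδ' using 1
    field_simp
  · have f1 : mass (schwartzH1 (rescale (δ * r) r hr φ), 0) = δ ^ 2 * m / r := by
      rw [e1]
      field_simp
    have f2 : 0 ≤ gradSq (schwartzH1 (rescale (δ * r) r hr φ), 0) := gradSq_nonneg _
    have f3 : quartic β (schwartzH1 (rescale (δ * r) r hr φ), 0) = δ ^ 4 * r * n := by
      rw [e3]
      field_simp
    have f4 : |J| + δ ^ 4 * n ≤ 1 / 2 * (δ ^ 2 * m / r) := by
      rw [← mul_div_assoc, le_div_iff₀ hr]
      linarith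
    have f5 : δ ^ 4 * r * n ≤ δ ^ 4 * n := by
      have : 0 ≤ δ ^ 4 * n := by positivity
      nlinarith
    have f6 : 0 ≤ δ ^ 4 * n := by positivity
    rw [action, energy, f1, f3]
    linarith [le_abs_self J]

/-! ### Comparison with the action threshold -/

theorem actionThreshold_le {β : ℝ} {w : H1 × H1} (hw : w ≠ 0) (hK : virial β w = 0) :
    actionThreshold β ≤ action β w := by
  -- On `K = 0` the quartic integral is `4A/3`, so `J = A/6 + M/2 ≥ 0`: the infimum is over a set
  -- bounded below.
  refine csInf_le ⟨0, ?_⟩ ⟨w, ⟨hw, hK⟩, rfl⟩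
  rintro _ ⟨z, ⟨-, hz⟩, rfl⟩
  rw [virial] at hz
  rw [action, energy]
  linarith [mass_nonneg z, gradSq_nonneg z]

end NLSSystem

end

theorem proposition7p1 (β : ℝ) (hβ : 0 < β) (P Q : NLSSystem.H1)
    (hPQ : NLSSystem.IsGroundState β (P, Q)) :
    NLSSystem.Kplus β ⊂ NLSSystem.scatteringSet β (P, Q) := by
  obtain ⟨hsol, hne, -⟩ := hPQ
  have hN := hsol.gradSq_add_mass
  have hP := hsol.pohozaev
  have hM := NLSSystem.mass_pos hne
  set M := NLSSystem.mass (P, Q)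
  have hA : NLSSystem.gradSq (P, Q) = 3 * M := by linarith
  have hE : NLSSystem.energy β (P, Q) = M / 2 := by
    rw [NLSSystem.energy]
    linarith
  have hJ : NLSSystem.actionThreshold β ≤ M := by
    refine (NLSSystem.actionThreshold_le hne (by rw [NLSSystem.virial]; linarith)).trans_eq ?_
    rw [NLSSystem.action, hE]
    ring
  refine ⟨fun z ⟨h1, h2⟩ ↦ ?_, fun hsub ↦ ?_⟩
  · have hm := NLSSystem.mass_nonneg z
    have ha := NLSSystem.gradSq_nonneg z
    have hen : NLSSystem.gradSq z ≤ 6 * NLSSystem.energy β z := by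
      rw [NLSSystem.virial] at h2
      rw [NLSSystem.energy]
      linarith
    have hlt : NLSSystem.energy β z + 1 / 2 * NLSSystem.mass z < M := h1.trans_le hJ
    -- `2mE ≤ (E + m/2)² < M²`, where `E ≥ A/6 ≥ 0` justifies squaring the strict bound.
    have hME : NLSSystem.mass z * NLSSystem.energy β z < M * (M / 2) := by
      nlinarith [sq_nonneg (NLSSystem.energy β z - 1 / 2 * NLSSystem.mass z)]
    constructor
    · rw [hE]
      exact hME
    · rw [hA]
      nlinarith
  · obtain ⟨z, hz1, hz2, hz3⟩ := NLSSystem.exists_action_ge β (NLSSystem.actionThreshold β)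
      (ε := M * M) (by positivity)
    have hz : z ∈ NLSSystem.scatteringSet β (P, Q) := by
      constructor
      · rw [hE, NLSSystem.energy]
        nlinarith [mul_nonneg (NLSSystem.mass_nonneg z) hz1]
      · rw [hA]
        nlinarith
    exact hz3.not_gt (hsub hz).1
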